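/- Let $\alpha\in(0,1)$ and let $\sigma,k:[0,\infty)\to\mathbb R$ be continuous and $\eta:[0,\infty)\to\mathbb R$ be continuous on $(0,\infty)$, with $\sigma_t>0$ for $t\ge 0$, and $k_t>0$, $\eta_t\ge 0$ for $t>0$. Put $\theta_t=\tfrac12+\eta_t$ and $G_t=\sqrt{\theta_t^2+2(1-\alpha)/(\sigma_t^2k_t)}$. Assume that on $(0,\infty)$ the functions $$g_1(t)=\theta_t-G_t,\qquad g_2(t)=-\theta_t-G_t,\qquad g_3(t)=\frac{t^{1/\alpha}\sigma_t^2}{k_t^{(1-\alpha)/\alpha}}\,G_t$$ are non-decreasing, and that $t\sigma_t^2\eta_t\to0$ and $t\sigma_t^{2\alpha}\eta_t^\alpha/k_t^{1-\alpha}\to0$ as $t\to0^+$. Let $(f_t)_{t\ge0}$ be a real process on a probability space with $f_0=0$ a.s., independent increments and stochastic continuity, whose characteristic function is, for $t>0$ and $u\in\mathbb R$, $$\mathbb E\,e^{iuf_t}=\exp\Big(\ell_t\big(iu\,\theta_t\sigma_t^2+\tfrac{u^2\sigma_t^2}{2}\big)-iu\,\ell_t(\eta_t\sigma_t^2)\Big),\qquad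 \ell_t(v)=\frac{t}{k_t}\,\frac{1-\alpha}{\alpha}\Big\{1-\Big(1+\frac{v\,k_t}{1-\alpha}\Big)^{\alpha}\Big\}$$ (an additive normal tempered stable process). Assume that no increment is trivial: for $0\le s<t$ it is not the case that $f_t=f_s$ almost surely. For $t\ge0$ let $-(p_t^++1)<\Im u<p_t^-$ be the largest open horizontal strip around the real axis to which the characteristic function of $f_t$ extends analytically ($p_0^\pm=+\infty$). For $t\geq 0$, let $$\nu_t(x)=\frac{t\,C_t}{|x|^{1/2+\alpha}}\,e^{-\theta_t x}K_{\alpha+1/2}(|x|G_t),\qquad C_t=\frac{2}{\Gamma(1-\alpha)\sqrt{2\pi}}\Big(\frac{1-\alpha}{k_t}\Big)^{1-\alpha}\sigma_t^{2\alpha}\,G_t^{\alpha+1/2}$$ for $x\ne 0$ (with $\nu_0=0$), where $K$ is the modified Bessel function of the second kind. Then $p_t^+>0$ and $p_t^->0$ for all $t\geq 0$, and: 1. $t\mapsto p_t^+$ and $t\mapsto p_t^-$ are non-increasing on $[0,\infty)$. 2. For all $0\le s<t$ the characteristic function $\phi_{s,t}$ of $f_t-f_s$ extends analytically to $-(p_t^++1)<\Im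 u<p_t^-$, and there are $B,b,\omega>0$ such that, for all sufficiently large real $u$, $$|\phi_{s,t}(u-ia)|<B\,e^{-b\,u^\omega}\qquad\text{for all } a\in(0,p_t^++1).$$ 3. $\nu_t$ is the density of the Lévy measure of the infinitely divisible law of $f_t$, for every $t\ge0$; and for all $0\le s<t$ and $\epsilon>0$ the integrals of $\nu_t-\nu_s$ over $(\epsilon,\infty)$ and over $(-\infty,-\epsilon)$ are finite and positive, the density $$m^+_{s,t}(x)=\mathbb I_{x>\epsilon}\,\frac{\nu_t(x)-\nu_s(x)}{\int_\epsilon^\infty(\nu_t(z)-\nu_s(z))\,dz}$$ is non-increasing on $(\epsilon,\infty)$, and the density $$m^-_{s,t}(x)=\mathbb I_{x<-\epsilon}\,\frac{\nu_t(x)-\nu_s(x)}{\int_{-\infty}^{-\epsilon}(\nu_t(z)-\nu_s(z))\,dz}$$ is non-decreasing on $(-\infty,-\epsilon)$. 4. $p_t^+\ge p_t^-$ for all $t\ge0$, and $p_t^+-p_t^-=2\eta_t$ for $t>0$. -/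

import Mathlib

open MeasureTheory ProbabilityTheory Filter Topology
open scoped NNReal

namespace AdditiveSim

/-! ### Additive processes -/

/-- A real additive process on the probability space `(Ω, P)`: it starts at `0` almost surely, has
independent increments and is stochastically continuous. Càdlàg paths are not required, so that
what is stated for this class covers the càdlàg processes in particular. -/
structure IsAdditiveProcess {Ω : Type*} [MeasurableSpace Ω] (P : Measure Ω)
    (f : ℝ≥0 → Ω → ℝ) : Prop where
  measurable : ∀ t, Measurable (f t)
  start_zero : f 0 =ᵐ[P] fun _ => 0
  indep_increments : HasIndepIncrements f P
  stochastically_continuous : ∀ t, TendstoInMeasure P f (𝓝 t) (f t)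

/-- The law of the process at time `t`. -/
noncomputable def law {Ω : Type*} [MeasurableSpace Ω] (P : Measure Ω) (f : ℝ≥0 → Ω → ℝ)
    (t : ℝ≥0) : Measure ℝ :=
  P.map (f t)

/-- The law of the increment `f t - f s`. -/
noncomputable def incrementLaw {Ω : Type*} [MeasurableSpace Ω] (P : Measure Ω)
    (f : ℝ≥0 → Ω → ℝ) (s t : ℝ≥0) : Measure ℝ :=
  P.map (fun ω => f t ω - f s ω)

/-! ### Analytic characteristic functions and the strip of regularity -/

/-- The open horizontal strip `a < Im z < b` of the complex plane. -/
def strip (a b : EReal) : Set ℂ :=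
  {z : ℂ | a < (z.im : EReal) ∧ (z.im : EReal) < b}

/-- `F` is the characteristic function of `m` as an analytic function on the strip
`a < Im z < b`: it is holomorphic there and agrees with the characteristic function on the real
line. For `a < 0 < b` it is unique on the strip. -/
def IsAnalyticCharFun (m : Measure ℝ) (a b : EReal) (F : ℂ → ℂ) : Prop :=
  DifferentiableOn ℂ F (strip a b) ∧ ∀ u : ℝ, F (u : ℂ) = charFun m u

/-- The upper end of the strip of regularity of the characteristic function of `m`. -/
noncomputable def stripUpper (m : Measure ℝ) : EReal :=
  sSup {b : EReal | 0 < b ∧ ∃ a : EReal, a < 0 ∧ ∃ F : ℂ → ℂ, IsAnalyticCharFun m a b F}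

/-- The lower end of the strip of regularity of the characteristic function of `m`. -/
noncomputable def stripLower (m : Measure ℝ) : EReal :=
  sInf {a : EReal | a < 0 ∧ ∃ b : EReal, 0 < b ∧ ∃ F : ℂ → ℂ, IsAnalyticCharFun m a b F}

/-- The strip of regularity at time `t` is `-(pPlus + 1) < Im u < pMinus`. -/
noncomputable def pMinus {Ω : Type*} [MeasurableSpace Ω] (P : Measure Ω) (f : ℝ≥0 → Ω → ℝ)
    (t : ℝ≥0) : EReal :=
  stripUpper (law P f t)

/-- The strip of regularity at time `t` is `-(pPlus + 1) < Im u < pMinus`. -/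
noncomputable def pPlus {Ω : Type*} [MeasurableSpace Ω] (P : Measure Ω) (f : ℝ≥0 → Ω → ℝ)
    (t : ℝ≥0) : EReal :=
  -stripLower (law P f t) - 1

/-! ### Jump measures -/

/-- The probability measure `m` is infinitely divisible with a Lévy measure that has density `n`
with respect to Lebesgue measure (Lévy-Khintchine formula with truncation `|x| ≤ 1`). -/
def IsJumpDensity (m : Measure ℝ) (n : ℝ → ℝ) : Prop :=
  (∀ x, 0 ≤ n x) ∧ Integrable (fun x => min 1 (x ^ 2) * n x) ∧
    ∃ A γ : ℝ, 0 ≤ A ∧ ∀ u : ℝ, charFun m u =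
      Complex.exp (-(A * u ^ 2 / 2 : ℝ) + Complex.I * u * γ +
        ∫ x : ℝ, (Complex.exp (Complex.I * u * x) - 1
          - (if |x| ≤ 1 then Complex.I * u * x else 0)) * (n x : ℂ))

/-- The density of the positive jumps of size larger than `ε` of the increment from `s` to `t`. -/
noncomputable def mPlus (ν : ℝ≥0 → ℝ → ℝ) (ε : ℝ) (s t : ℝ≥0) (x : ℝ) : ℝ :=
  (Set.Ioi ε).indicator (fun y => (ν t y - ν s y) / ∫ z in Set.Ioi ε, (ν t z - ν s z)) x

/-- The density of the negative jumps of size larger than `ε` of the increment from `s` to `t`. -/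
noncomputable def mMinus (ν : ℝ≥0 → ℝ → ℝ) (ε : ℝ) (s t : ℝ≥0) (x : ℝ) : ℝ :=
  (Set.Iio (-ε)).indicator
    (fun y => (ν t y - ν s y) / ∫ z in Set.Iio (-ε), (ν t z - ν s z)) x

/-! ### The three properties of the process -/

/-- `p_t^+` and `p_t^-` are non-increasing in `t`. -/
def StripNonincreasing {Ω : Type*} [MeasurableSpace Ω] (P : Measure Ω) (f : ℝ≥0 → Ω → ℝ) : Prop :=
  Antitone (pPlus P f) ∧ Antitone (pMinus P f)

/-- For `s < t` the characteristic function of the increment is analytic on the strip of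
regularity of time `t`, and it decays like a stretched exponential along the horizontal lines
`Im = -a`, uniformly in `0 < a < p_t^+ + 1`. -/
def IncrementCharFunDecay {Ω : Type*} [MeasurableSpace Ω] (P : Measure Ω) (f : ℝ≥0 → Ω → ℝ) : Prop :=
  ∀ s t : ℝ≥0, s < t →
    ∃ φ : ℂ → ℂ,
      IsAnalyticCharFun (incrementLaw P f s t) (-(pPlus P f t + 1)) (pMinus P f t) φ ∧
      ∃ B b ω : ℝ, 0 < B ∧ 0 < b ∧ 0 < ω ∧
        ∀ᶠ u : ℝ in atTop, ∀ a : ℝ, 0 < a → (a : EReal) < pPlus P f t + 1 →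
          ‖φ ((u : ℂ) - Complex.I * (a : ℂ))‖ < B * Real.exp (-b * u ^ ω)

/-- `ν t` is the density of the jump measure of `f t` for every `t`, and for all `s < t` and every
truncation level `ε > 0` the truncated jump densities `m^±` are well defined (the normalizing
integrals are finite and positive), with `m^+` non-increasing on `x > ε` and `m^-` non-decreasing
on `x < -ε`. -/
def JumpDensitiesMonotone {Ω : Type*} [MeasurableSpace Ω] (P : Measure Ω) (f : ℝ≥0 → Ω → ℝ)
    (ν : ℝ≥0 → ℝ → ℝ) : Prop :=
  (∀ t, IsJumpDensity (law P f t) (ν t)) ∧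
  ∀ s t : ℝ≥0, s < t → ∀ ε : ℝ, 0 < ε →
    (IntegrableOn (fun x => ν t x - ν s x) (Set.Ioi ε) ∧
      0 < (∫ x in Set.Ioi ε, (ν t x - ν s x)) ∧
      AntitoneOn (mPlus ν ε s t) (Set.Ioi ε)) ∧
    (IntegrableOn (fun x => ν t x - ν s x) (Set.Iio (-ε)) ∧
      0 < (∫ x in Set.Iio (-ε), (ν t x - ν s x)) ∧
      MonotoneOn (mMinus ν ε s t) (Set.Iio (-ε)))

/-! ### Additive normal tempered stable processes -/

/-- `ln L_t(v; k, α) = (t / k) ((1 - α) / α) (1 - (1 + v k / (1 - α)) ^ α)`, with the principal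
branch of the power. -/
noncomputable def lnL (α : ℝ) (t : ℝ≥0) (k : ℝ) (v : ℂ) : ℂ :=
  ((t : ℝ) / k : ℝ) * ((1 - α) / α : ℝ) * (1 - (1 + v * k / (1 - α : ℝ)) ^ (α : ℂ))

/-- The characteristic function of an additive normal tempered stable process at time `t`. -/
noncomputable def atsCharFun (α : ℝ) (σ k η : ℝ≥0 → ℝ) (t : ℝ≥0) (u : ℝ) : ℂ :=
  Complex.exp
    (lnL α t (k t)
        (Complex.I * u * ((1 / 2 + η t : ℝ) : ℂ) * ((σ t) ^ 2 : ℝ)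
          + (u : ℂ) ^ 2 * ((σ t) ^ 2 : ℝ) / 2)
      - Complex.I * u * lnL α t (k t) ((η t * (σ t) ^ 2 : ℝ) : ℂ))

/-- The square root `√((1/2 + η_t)² + 2 (1 - α) / (σ_t² k_t))`. -/
noncomputable def atsRoot (α : ℝ) (σ k η : ℝ≥0 → ℝ) (t : ℝ≥0) : ℝ :=
  Real.sqrt ((1 / 2 + η t) ^ 2 + 2 * (1 - α) / ((σ t) ^ 2 * k t))

noncomputable def g₁ (α : ℝ) (σ k η : ℝ≥0 → ℝ) (t : ℝ≥0) : ℝ :=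
  (1 / 2 + η t) - atsRoot α σ k η t

noncomputable def g₂ (α : ℝ) (σ k η : ℝ≥0 → ℝ) (t : ℝ≥0) : ℝ :=
  -(1 / 2 + η t) - atsRoot α σ k η t

noncomputable def g₃ (α : ℝ) (σ k η : ℝ≥0 → ℝ) (t : ℝ≥0) : ℝ :=
  (t : ℝ) ^ (1 / α) * (σ t) ^ 2 / (k t) ^ ((1 - α) / α) * atsRoot α σ k η t

/-- The standing conditions on the parameters of an additive normal tempered stable process,
including the sufficient conditions for its existence. The parameter `k` may vanish at time `0`
only, since one divides by it at positive times. -/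
structure IsATSParameters (α : ℝ) (σ k η : ℝ≥0 → ℝ) : Prop where
  continuous_σ : Continuous σ
  continuous_k : Continuous k
  continuousOn_η : ContinuousOn η (Set.Ioi 0)
  σ_pos : ∀ t, 0 < σ t
  k_pos : ∀ t, 0 < t → 0 < k t
  η_nonneg : ∀ t, 0 < t → 0 ≤ η t
  g₁_mono : MonotoneOn (g₁ α σ k η) (Set.Ioi 0)
  g₂_mono : MonotoneOn (g₂ α σ k η) (Set.Ioi 0)
  g₃_mono : MonotoneOn (g₃ α σ k η) (Set.Ioi 0)
  tendsto_drift : Tendsto (fun t : ℝ≥0 => (t : ℝ) * (σ t) ^ 2 * η t) (𝓝[>] 0) (𝓝 0)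
  tendsto_skew : Tendsto
    (fun t : ℝ≥0 => (t : ℝ) * (σ t) ^ (2 * α) * (η t) ^ α / (k t) ^ (1 - α)) (𝓝[>] 0) (𝓝 0)

/-- `f` is an additive normal tempered stable process on `(Ω, P)` with the given parameters. -/
structure IsATSProcess {Ω : Type*} [MeasurableSpace Ω] (P : Measure Ω) (α : ℝ)
    (σ k η : ℝ≥0 → ℝ) (f : ℝ≥0 → Ω → ℝ) : Prop where
  additive : IsAdditiveProcess P f
  charFun_eq : ∀ (t : ℝ≥0) (u : ℝ), charFun (law P f t) u = atsCharFun α σ k η t u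

/-- The modified Bessel function of the second kind, for `x > 0` and order larger than `-1/2`. -/
noncomputable def besselK (r x : ℝ) : ℝ :=
  Real.exp (-x) / Real.Gamma (r + 1 / 2) * Real.sqrt (Real.pi / (2 * x)) *
    ∫ z in Set.Ioi (0 : ℝ),
      Real.exp (-z) * z ^ (r - 1 / 2) * (1 + z / (2 * x)) ^ (r - 1 / 2)

/-- The constant `C(α, k_t, σ_t, η_t)` of the jump density. -/
noncomputable def atsJumpConst (α : ℝ) (σ k η : ℝ≥0 → ℝ) (t : ℝ≥0) : ℝ :=
  2 / (Real.Gamma (1 - α) * Real.sqrt (2 * Real.pi)) * ((1 - α) / k t) ^ (1 - α)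
    * (σ t) ^ (2 * α)
    * ((1 / 2 + η t) ^ 2 + 2 * (1 - α) / (k t * (σ t) ^ 2)) ^ (α / 2 + 1 / 4)

/-- The jump density of an additive normal tempered stable process at time `t`. -/
noncomputable def atsJumpDensity (α : ℝ) (σ k η : ℝ≥0 → ℝ) (t : ℝ≥0) (x : ℝ) : ℝ :=
  (t : ℝ) * atsJumpConst α σ k η t / |x| ^ (1 / 2 + α) * Real.exp (-(1 / 2 + η t) * x)
    * besselK (α + 1 / 2)
        (|x| * Real.sqrt ((1 / 2 + η t) ^ 2 + 2 * (1 - α) / (k t * (σ t) ^ 2)))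

end AdditiveSim

namespace AdditiveSim

/-! For `t > 0` the quadratic inside `lnL` factors. With `a = G + θ`, `b = G - θ` and a scale `B >
0`, the characteristic function is `exp (B (ab)^α - B ((a - iz)(b + iz))^α - icz)`
(`atsCharFun_eq_exp`), and everything is read off from `(a, b, B)`.

The base `(a - iz)(b + iz)` stays in the right half-plane for `-a < Im z < b`. It vanishes at `-ia`
and `ib`, where the power `α < 1` has infinite slope, so the strip of regularity ends exactly there.
Thus `p⁺ = a - 1` and `p⁻ = b`, which gives their signs and their difference `2θ - 1 = 2η`.

Since `g₁ = -b` and `g₂ = -a`, both `a` and `b` are non-increasing in time. The condition on `g₃`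
says that `B (a + b)^α` is non-decreasing. Hence `B` is non-decreasing, and if it took the same
value at two positive times, `a`, `b` and the drift would agree too; the laws would coincide and the
increment would be trivial. So `B` is strictly increasing (`atsScale_lt`). The characteristic
function of an increment is the quotient of those at its two times. As the base is `u² (1 + O(1/u))`
uniformly on horizontal lines of the lower half of the strip, the quotient decays like `exp (-const
* u^(2α))`.

The integral for the Bessel function turns the jump density into `D ∫_G^∞ (w² - G²)^α exp (-w|x| -
θx) dw` with `D = B / (Γ(α) Γ(1 - α))` (`atsJumpDensity_eq_expMixture`). For the Lévy-Khintchine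
formula one integrates in `x` first; the substitution `l = w² - G²` leaves a Stieltjes integral for
`z^α` (`integral_compensated_mul_expMixture`). For monotonicity, the density on `x > 0` is the
Laplace transform of `D ((q - a)₊ (q + b))^α`, and on `x < 0` the same holds with `a` and `b`
exchanged. These kernels increase with time (`stableKernel_weighted`), so a difference of densities
is again the Laplace transform of a nonnegative kernel. -/

/-! ### The exponent of a tempered stable law and its strip of regularity -/

/-- The characteristic exponent `B (a b) ^ α - B ((a - i z) (b + i z)) ^ α - i c z`. -/
noncomputable def stableExponent (α a b B c : ℝ) (z : ℂ) : ℂ :=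
  ((B * (a * b) ^ α : ℝ) : ℂ) - B * ((a - Complex.I * z) * (b + Complex.I * z)) ^ (α : ℂ)
    - Complex.I * z * c

/-- The real part is `(a + Im z)(b - Im z) + (Re z)²`. On the strip the base therefore avoids the
cut of the principal power. -/
theorem stableBase_re_pos {a b : ℝ} {z : ℂ} (h1 : -a < z.im) (h2 : z.im < b) :
    0 < ((a - Complex.I * z) * (b + Complex.I * z)).re := by
  have : 0 < (a + z.im) * (b - z.im) := mul_pos (by linarith) (by linarith)
  simp
  nlinarith [sq_nonneg z.re]

theorem stableBase_mem_slitPlane {a b : ℝ} {z : ℂ} (h1 : -a < z.im) (h2 : z.im < b) :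
    ((a - Complex.I * z) * (b + Complex.I * z)) ∈ Complex.slitPlane :=
  Or.inl (stableBase_re_pos h1 h2)

theorem mem_strip_coe {a b : ℝ} {z : ℂ} :
    z ∈ strip ((a : ℝ) : EReal) ((b : ℝ) : EReal) ↔ a < z.im ∧ z.im < b := by
  simp [strip]

theorem differentiableOn_stableExponent (α a b B c : ℝ) :
    DifferentiableOn ℂ (stableExponent α a b B c) (strip ((-a : ℝ) : EReal) ((b : ℝ) : EReal)) := by
  intro z hz
  rw [mem_strip_coe] at hz
  have h := stableBase_mem_slitPlane hz.1 hz.2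
  have hd : DifferentiableAt ℂ (fun z : ℂ => (a - Complex.I * z) * (b + Complex.I * z)) z := by
    fun_prop
  have hp : DifferentiableAt ℂ
      (fun z : ℂ => ((a - Complex.I * z) * (b + Complex.I * z)) ^ (α : ℂ)) z :=
    hd.cpow (differentiableAt_const _) h
  apply DifferentiableAt.differentiableWithinAt
  unfold stableExponent
  fun_prop

theorem isOpen_strip (a b : EReal) : IsOpen (strip a b) := by
  have hc : Continuous (fun z : ℂ => (z.im : EReal)) :=
    continuous_coe_real_ereal.comp Complex.continuous_im
  exact (isOpen_lt continuous_const hc).inter (isOpen_lt hc continuous_const)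

theorem convex_strip (a b : EReal) : Convex ℝ (strip a b) := by
  have : strip a b = Complex.imLm ⁻¹' ((fun x : ℝ => (x : EReal)) ⁻¹' Set.Ioo a b) := rfl
  rw [this]
  refine Convex.linear_preimage ?_ _
  exact (Set.ordConnected_Ioo.preimage_mono fun x y h => EReal.coe_le_coe_iff.2 h).convex

/-- Two analytic characteristic functions of the same measure agree on the common strip. -/
theorem IsAnalyticCharFun.eqOn {m : Measure ℝ} {a b a' b' : EReal} {F G : ℂ → ℂ}
    (hF : IsAnalyticCharFun m a b F) (hG : IsAnalyticCharFun m a' b' G)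
    (ha : a < 0) (hb : 0 < b) (ha' : a' < 0) (hb' : 0 < b') :
    Set.EqOn F G (strip a b ∩ strip a' b') := by
  have hopen : IsOpen (strip a b ∩ strip a' b') := (isOpen_strip _ _).inter (isOpen_strip _ _)
  have h0 : (0 : ℂ) ∈ strip a b ∩ strip a' b' := by
    simp [strip, *]
  refine AnalyticOnNhd.eqOn_of_preconnected_of_frequently_eq
    ((hF.1.mono Set.inter_subset_left).analyticOnNhd hopen)
    ((hG.1.mono Set.inter_subset_right).analyticOnNhd hopen)
    ((convex_strip a b).inter (convex_strip a' b')).isPreconnected h0 ?_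
  have ht : Tendsto (fun x : ℝ => (x : ℂ)) (𝓝[≠] 0) (𝓝[≠] 0) := by
    refine tendsto_nhdsWithin_of_tendsto_nhds_of_eventually_within _ ?_ ?_
    · exact (Complex.continuous_ofReal.tendsto' 0 0 (by simp)).mono_left nhdsWithin_le_nhds
    · filter_upwards [self_mem_nhdsWithin] with x hx
      simpa using hx
  refine ht.frequently (Eventually.frequently (Eventually.of_forall fun x => ?_))
  rw [hF.2, hG.2]

/-- The exponential of a tempered stable exponent is not differentiable at the end of its strip. -/
theorem not_differentiableAt_of_eq_exp_stable {α a b A B c : ℝ} (hα0 : 0 < α) (hα1 : α < 1)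
    (ha : 0 < a) (hb : 0 < b) (hB : 0 < B) {h : ℝ → ℂ} (hd : DifferentiableAt ℝ h b)
    (heq : ∀ y ∈ Set.Ioo 0 b,
      h y = (Real.exp (A - B * ((a + y) * (b - y)) ^ α + y * c) : ℝ)) : False := by
  have hev : ∀ᶠ y in 𝓝[<] b, y ∈ Set.Ioo 0 b := Ioo_mem_nhdsLT hb
  have hre : DifferentiableAt ℝ (fun y => (h y).re) b := Complex.reCLM.differentiableAt.comp b hd
  have hcont : Tendsto (fun y : ℝ => Real.exp (A - B * ((a + y) * (b - y)) ^ α + y * c)) (𝓝[<] b)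
      (𝓝 (Real.exp (A + b * c))) := by
    have : Continuous fun y : ℝ => Real.exp (A - B * ((a + y) * (b - y)) ^ α + y * c) :=
      Real.continuous_exp.comp ((continuous_const.sub (continuous_const.mul
        (Continuous.rpow_const (by fun_prop) fun _ => Or.inr hα0.le))).add (by fun_prop))
    refine (this.tendsto' b _ ?_).mono_left nhdsWithin_le_nhds
    simp [Real.zero_rpow hα0.ne']
  have hval : (h b).re = Real.exp (A + b * c) := by
    have h1 : Tendsto (fun y => (h y).re) (𝓝[<] b) (𝓝 (h b).re) :=
      hre.continuousAt.tendsto.mono_left nhdsWithin_le_nhds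
    refine tendsto_nhds_unique h1 (hcont.congr' ?_)
    filter_upwards [hev] with y hy
    rw [heq y hy, Complex.ofReal_re]
  -- The logarithm isolates `-B ((a + y)(b - y))^α`; differentiability at `b` would make it `O(b -
  -- y)`, while it is of order `(b - y)^α` with `α < 1`.
  have hlog : DifferentiableAt ℝ (fun y => Real.log (h y).re - A - y * c) b := by
    refine ((hre.log ?_).sub_const _).sub (by fun_prop)
    rw [hval]
    positivity
  have hO := hlog.isBigO_sub
  rw [hval, Real.log_exp] at hO
  obtain ⟨K, hK⟩ := (hO.mono (nhdsWithin_le_nhds (s := Set.Iio b))).bound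
  have hK' : ∀ᶠ y in 𝓝[<] b, B * a ^ α * (b - y) ^ (α - 1) ≤ K := by
    filter_upwards [hK, hev] with y hy hy'
    obtain ⟨hy0, hyb⟩ := hy'
    have hpos : 0 < b - y := by linarith
    rw [heq y ⟨hy0, hyb⟩, Complex.ofReal_re, Real.log_exp] at hy
    rw [Real.norm_eq_abs, Real.norm_eq_abs, abs_sub_comm y b, abs_of_pos hpos] at hy
    have h2 : B * ((a + y) * (b - y)) ^ α ≤ K * (b - y) := by
      refine le_trans ?_ hy
      rw [show A - B * ((a + y) * (b - y)) ^ α + y * c - A - y * c - (A + b * c - A - b * c)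
        = -(B * ((a + y) * (b - y)) ^ α) by ring, abs_neg]
      exact le_abs_self _
    have h3 : B * (a ^ α * (b - y) ^ α) ≤ K * (b - y) := by
      refine le_trans ?_ h2
      rw [← Real.mul_rpow ha.le hpos.le]
      gcongr
      linarith
    rw [Real.rpow_sub_one hpos.ne', ← mul_div_assoc, div_le_iff₀ hpos]
    linarith
  have ht : Tendsto (fun y : ℝ => B * a ^ α * (b - y) ^ (α - 1)) (𝓝[<] b) atTop := by
    refine Tendsto.const_mul_atTop (by positivity) ?_
    refine (tendsto_rpow_neg_nhdsGT_zero (by linarith : α - 1 < 0)).comp ?_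
    refine tendsto_nhdsWithin_of_tendsto_nhds_of_eventually_within _ ?_ ?_
    · exact ((by fun_prop : Continuous fun y : ℝ => b - y).tendsto' b 0 (by simp)).mono_left
        nhdsWithin_le_nhds
    · filter_upwards [self_mem_nhdsWithin] with y hy
      simpa using hy
  obtain ⟨y, hy1, hy2⟩ := (hK'.and (ht.eventually_gt_atTop K)).exists
  linarith

/-- On the imaginary axis everything is real, and the base vanishes to first order at the ends of
the strip; this is where the singularity is detected. -/
theorem exp_stableExponent_mul_I {α a b B c y : ℝ} (h1 : -a < y) (h2 : y < b) :
    Complex.exp (stableExponent α a b B c (y * Complex.I))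
      = (Real.exp (B * (a * b) ^ α - B * ((a + y) * (b - y)) ^ α + y * c) : ℝ) := by
  have h3 : 0 ≤ (a + y) * (b - y) := mul_nonneg (by linarith) (by linarith)
  have e1 : ((a : ℂ) - Complex.I * (y * Complex.I)) * (b + Complex.I * (y * Complex.I))
      = (((a + y) * (b - y) : ℝ) : ℂ) := by
    push_cast
    linear_combination (-(y : ℂ) * b + a * y - y ^ 2 * Complex.I ^ 2 + y ^ 2) * Complex.I_sq
  rw [stableExponent, e1, ← Complex.ofReal_cpow h3, Complex.ofReal_exp]
  congr 1
  push_cast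
  linear_combination (-(y : ℂ) * c) * Complex.I_sq

theorem isAnalyticCharFun_stable {m : Measure ℝ} {α a b B c : ℝ}
    (hm : ∀ u : ℝ, charFun m u = Complex.exp (stableExponent α a b B c u)) :
    IsAnalyticCharFun m ((-a : ℝ) : EReal) (b : EReal)
      (fun z => Complex.exp (stableExponent α a b B c z)) :=
  ⟨(differentiableOn_stableExponent α a b B c).cexp, fun u => (hm u).symm⟩

/-- A strip reaching above `b` contains `ib`. Its analytic function equals the exponential on the
segment from `0` to `ib` by uniqueness, so it would be differentiable at a point where the
exponential has infinite slope. -/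
theorem stripUpper_stable {m : Measure ℝ} {α a b B c : ℝ} (hα0 : 0 < α) (hα1 : α < 1)
    (ha : 0 < a) (hb : 0 < b) (hB : 0 < B)
    (hm : ∀ u : ℝ, charFun m u = Complex.exp (stableExponent α a b B c u)) :
    stripUpper m = b := by
  have hE := isAnalyticCharFun_stable hm
  have ha' : ((-a : ℝ) : EReal) < 0 := by exact_mod_cast neg_neg_of_pos ha
  have hb' : (0 : EReal) < b := by exact_mod_cast hb
  refine le_antisymm (sSup_le ?_) (le_sSup ⟨hb', _, ha', _, hE⟩)
  rintro b₁ ⟨hb₁, a₁, ha₁, F, hF⟩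
  by_contra! hlt
  have heq := hF.eqOn hE ha₁ hb₁ ha' hb'
  have hdF : DifferentiableAt ℂ F ((b : ℂ) * Complex.I) := by
    refine hF.1.differentiableAt ((isOpen_strip a₁ b₁).mem_nhds ?_)
    simp only [strip, Set.mem_ofPred_eq]
    simpa using ⟨ha₁.trans hb', hlt⟩
  refine not_differentiableAt_of_eq_exp_stable (h := fun y : ℝ => F (y * Complex.I))
    (A := B * (a * b) ^ α) (c := c) hα0 hα1 ha hb hB ?_ ?_
  · exact (hdF.restrictScalars ℝ).comp b (f := fun y : ℝ => (y : ℂ) * Complex.I)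
      (Complex.ofRealCLM.differentiableAt.mul_const _)
  · intro y hy
    have hy0 : (0 : EReal) < (y : EReal) := by exact_mod_cast hy.1
    have hyb : (y : EReal) < (b : EReal) := by exact_mod_cast hy.2
    rw [← exp_stableExponent_mul_I (by linarith [hy.1]) hy.2]
    refine heq ⟨?_, ?_⟩
    · simp only [strip, Set.mem_ofPred_eq]
      simpa using ⟨ha₁.trans hy0, hyb.trans hlt⟩
    · rw [mem_strip_coe]
      simpa using ⟨by linarith [hy.1], hy.2⟩

theorem stripLower_stable {m : Measure ℝ} {α a b B c : ℝ} (hα0 : 0 < α) (hα1 : α < 1)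
    (ha : 0 < a) (hb : 0 < b) (hB : 0 < B)
    (hm : ∀ u : ℝ, charFun m u = Complex.exp (stableExponent α a b B c u)) :
    stripLower m = ((-a : ℝ) : EReal) := by
  have hE := isAnalyticCharFun_stable hm
  have ha' : ((-a : ℝ) : EReal) < 0 := by exact_mod_cast neg_neg_of_pos ha
  have hb' : (0 : EReal) < b := by exact_mod_cast hb
  refine le_antisymm (sInf_le ⟨ha', _, hb', _, hE⟩) (le_sInf ?_)
  rintro a₁ ⟨ha₁, b₁, hb₁, F, hF⟩
  by_contra! hlt
  have heq := hF.eqOn hE ha₁ hb₁ ha' hb'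
  have hdF : DifferentiableAt ℂ F (((-a : ℝ) : ℂ) * Complex.I) := by
    refine hF.1.differentiableAt ((isOpen_strip a₁ b₁).mem_nhds ?_)
    simp only [strip, Set.mem_ofPred_eq]
    have : (((-a : ℝ) : ℂ) * Complex.I).im = -a := by simp
    rw [this]
    exact ⟨hlt, ha'.trans hb₁⟩
  -- The reflection `y ↦ -y` exchanges `a` with `b` and changes the sign of `c`.
  refine not_differentiableAt_of_eq_exp_stable
    (h := fun y : ℝ => F (((-y : ℝ) : ℂ) * Complex.I))
    (A := B * (a * b) ^ α) (c := -c) hα0 hα1 hb ha hB ?_ ?_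
  · refine (hdF.restrictScalars ℝ).comp a (f := fun y : ℝ => ((-y : ℝ) : ℂ) * Complex.I) ?_
    exact (Complex.ofRealCLM.differentiableAt.comp a (differentiableAt_id.neg)).mul_const _
  · intro y hy
    have hy0 : ((-y : ℝ) : EReal) < 0 := by exact_mod_cast neg_neg_of_pos hy.1
    have hyb : ((-a : ℝ) : EReal) < ((-y : ℝ) : EReal) := by exact_mod_cast neg_lt_neg hy.2
    have e := exp_stableExponent_mul_I (α := α) (a := a) (b := b) (B := B) (c := c) (y := -y)
      (by linarith [hy.2]) (by linarith [hy.1])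
    rw [show B * (a * b) ^ α - B * ((b + y) * (a - y)) ^ α + y * -c =
      B * (a * b) ^ α - B * ((a + -y) * (b - -y)) ^ α + -y * c by ring_nf, ← e]
    have him : (((-y : ℝ) : ℂ) * Complex.I).im = -y := by simp
    refine heq ⟨?_, ?_⟩
    · simp only [strip, Set.mem_ofPred_eq, him]
      exact ⟨hlt.trans hyb, hy0.trans hb₁⟩
    · rw [mem_strip_coe, him]
      exact ⟨by linarith [hy.2], by linarith [hy.1]⟩

theorem stripUpper_of_charFun_eq_one {m : Measure ℝ} (hm : ∀ u : ℝ, charFun m u = 1) :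
    stripUpper m = ⊤ :=
  top_le_iff.1 (le_sSup ⟨EReal.zero_lt_top, ⊥, EReal.bot_lt_zero, fun _ => 1,
    differentiableOn_const _, fun u => (hm u).symm⟩)

theorem stripLower_of_charFun_eq_one {m : Measure ℝ} (hm : ∀ u : ℝ, charFun m u = 1) :
    stripLower m = ⊥ :=
  le_bot_iff.1 (sInf_le ⟨EReal.bot_lt_zero, ⊤, EReal.zero_lt_top, fun _ => 1,
    differentiableOn_const _, fun u => (hm u).symm⟩)

/-! ### The parameters of an additive normal tempered stable process -/

/-- The distance from the real axis to the lower end of the strip of regularity. -/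
noncomputable def atsLower (α : ℝ) (σ k η : ℝ≥0 → ℝ) (t : ℝ≥0) : ℝ :=
  atsRoot α σ k η t + (1 / 2 + η t)

/-- The distance from the real axis to the upper end of the strip of regularity. -/
noncomputable def atsUpper (α : ℝ) (σ k η : ℝ≥0 → ℝ) (t : ℝ≥0) : ℝ :=
  atsRoot α σ k η t - (1 / 2 + η t)

/-- The coefficient of the power in the characteristic exponent. -/
noncomputable def atsScale (α : ℝ) (σ k : ℝ≥0 → ℝ) (t : ℝ≥0) : ℝ :=
  (t : ℝ) / k t * ((1 - α) / α) * ((σ t) ^ 2 * k t / (2 * (1 - α))) ^ α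

/-- The linear coefficient of the characteristic exponent. -/
noncomputable def atsDrift (α : ℝ) (σ k η : ℝ≥0 → ℝ) (t : ℝ≥0) : ℝ :=
  (t : ℝ) / k t * ((1 - α) / α) * (1 - (1 + η t * ((σ t) ^ 2 * k t) / (1 - α)) ^ α)

section

variable {α : ℝ} {σ k η : ℝ≥0 → ℝ} {t : ℝ≥0}

theorem atsRoot_sq (hα1 : α < 1) (hpar : IsATSParameters α σ k η) (ht : 0 < t) :
    atsRoot α σ k η t ^ 2 = (1 / 2 + η t) ^ 2 + 2 * (1 - α) / ((σ t) ^ 2 * k t) := by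
  have := hpar.k_pos t ht
  have := sub_pos.2 hα1
  exact Real.sq_sqrt (by positivity)

theorem half_add_lt_atsRoot (hα1 : α < 1) (hpar : IsATSParameters α σ k η) (ht : 0 < t) :
    1 / 2 + η t < atsRoot α σ k η t := by
  have := hpar.k_pos t ht
  have := hpar.σ_pos t
  have := sub_pos.2 hα1
  refine Real.lt_sqrt_of_sq_lt ?_
  have : 0 < 2 * (1 - α) / ((σ t) ^ 2 * k t) := by positivity
  linarith

theorem atsRoot_pos (hα1 : α < 1) (hpar : IsATSParameters α σ k η) (ht : 0 < t) :
    0 < atsRoot α σ k η t := by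
  linarith [half_add_lt_atsRoot hα1 hpar ht, hpar.η_nonneg t ht]

theorem one_lt_atsLower (hα1 : α < 1) (hpar : IsATSParameters α σ k η) (ht : 0 < t) :
    1 < atsLower α σ k η t := by
  unfold atsLower
  linarith [half_add_lt_atsRoot hα1 hpar ht, hpar.η_nonneg t ht]

theorem atsUpper_pos (hα1 : α < 1) (hpar : IsATSParameters α σ k η) (ht : 0 < t) :
    0 < atsUpper α σ k η t :=
  sub_pos.2 (half_add_lt_atsRoot hα1 hpar ht)

theorem atsLower_mul_atsUpper (hα1 : α < 1) (hpar : IsATSParameters α σ k η) (ht : 0 < t) :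
    atsLower α σ k η t * atsUpper α σ k η t = 2 * (1 - α) / ((σ t) ^ 2 * k t) := by
  unfold atsLower atsUpper
  linear_combination atsRoot_sq hα1 hpar ht

theorem atsScale_pos (hα0 : 0 < α) (hα1 : α < 1) (hpar : IsATSParameters α σ k η) (ht : 0 < t) :
    0 < atsScale α σ k t := by
  have := hpar.k_pos t ht
  have := hpar.σ_pos t
  have := sub_pos.2 hα1
  have : (0 : ℝ) < t := ht
  unfold atsScale
  positivity

/-- The factor `t = 0` decides, even if `k 0 = 0`, because `0 / 0 = 0`. The same applies to
`atsCharFun_zero`. -/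
theorem atsScale_zero : atsScale α σ k 0 = 0 := by
  simp [atsScale]

theorem atsCharFun_zero (u : ℝ) : atsCharFun α σ k η 0 u = 1 := by
  simp [atsCharFun, lnL]

/-- A positive real factor leaves the argument unchanged, so no branch correction appears. -/
theorem ofReal_mul_cpow {r : ℝ} (hr : 0 < r) {z : ℂ} (hz : z ≠ 0) (x : ℝ) :
    ((r : ℂ) * z) ^ (x : ℂ) = ((r ^ x : ℝ) : ℂ) * z ^ (x : ℂ) := by
  have hr' : (r : ℂ) ≠ 0 := by exact_mod_cast hr.ne'
  rw [Complex.cpow_def_of_ne_zero (mul_ne_zero hr' hz), Complex.cpow_def_of_ne_zero hz,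
    Complex.log_ofReal_mul hr hz, add_mul, Complex.exp_add, Real.rpow_def_of_pos hr]
  push_cast
  rfl

/-- With `κ = σ² k / (2 (1 - α))` one has `κ a b = 1` and `a - b = 2θ`, whence `1 + v k / (1 - α) =
κ (a - iu)(b + iu)`. The factor `κ^α` goes into the scale and `κ^α (ab)^α = 1` accounts for the
constant term. -/
theorem atsCharFun_eq_exp (hα0 : 0 < α) (hα1 : α < 1) (hpar : IsATSParameters α σ k η)
    (ht : 0 < t) (u : ℝ) :
    atsCharFun α σ k η t u = Complex.exp (stableExponent α (atsLower α σ k η t)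
      (atsUpper α σ k η t) (atsScale α σ k t) (atsDrift α σ k η t) u) := by
  have hk := hpar.k_pos t ht
  have hσ := hpar.σ_pos t
  have hη := hpar.η_nonneg t ht
  have h1 := sub_pos.2 hα1
  have ha := one_lt_atsLower hα1 hpar ht
  have hb := atsUpper_pos hα1 hpar ht
  have hab := atsLower_mul_atsUpper hα1 hpar ht
  set κ : ℝ := (σ t) ^ 2 * k t / (2 * (1 - α)) with hκ
  have hκ0 : 0 < κ := by positivity
  have hκab : κ * (atsLower α σ k η t * atsUpper α σ k η t) = 1 := by
    rw [hab, hκ]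
    field_simp
  have hdiff : atsLower α σ k η t - atsUpper α σ k η t = 2 * (1 / 2 + η t) := by
    unfold atsLower atsUpper
    ring
  set a := atsLower α σ k η t
  set b := atsUpper α σ k η t
  set w : ℂ := (a - Complex.I * u) * (b + Complex.I * u) with hw
  have hw0 : w ≠ 0 := by
    have : 0 < w.re := stableBase_re_pos (by simpa using by linarith) (by simpa using hb)
    intro h
    simp [h] at this
  have h1C : (1 : ℂ) - (α : ℂ) ≠ 0 := by exact_mod_cast h1.ne'
  have hbase : (1 : ℂ) + (Complex.I * u * ((1 / 2 + η t : ℝ) : ℂ) * ((σ t) ^ 2 : ℝ)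
      + (u : ℂ) ^ 2 * ((σ t) ^ 2 : ℝ) / 2) * (k t : ℝ) / (1 - α : ℝ) = (κ : ℂ) * w := by
    have e1 : (κ : ℂ) * (a * b) = 1 := by exact_mod_cast hκab
    have e2 : (a : ℂ) - b = 2 * ((1 / 2 + η t : ℝ) : ℂ) := by exact_mod_cast hdiff
    have e3 : (κ : ℂ) = ((σ t) ^ 2 : ℝ) * (k t : ℝ) / (2 * (1 - α : ℝ)) := by
      rw [hκ]; push_cast; rfl
    have e4 : (κ : ℂ) * w = κ * (a * b) + κ * (Complex.I * u * (a - b)) + κ * u ^ 2 := by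
      rw [hw]
      linear_combination (-(κ : ℂ) * u ^ 2) * Complex.I_sq
    rw [e4, e1, e2, e3]
    push_cast
    field_simp
    ring
  have hpow : κ ^ α * (a * b) ^ α = 1 := by
    rw [← Real.mul_rpow hκ0.le (by positivity), hκab, Real.one_rpow]
  have hA : atsScale α σ k t * (a * b) ^ α = (t : ℝ) / k t * ((1 - α) / α) := by
    rw [atsScale, mul_assoc, hpow, mul_one]
  have hB : (atsScale α σ k t : ℂ) = ((t : ℝ) / k t : ℝ) * ((1 - α) / α : ℝ) * (κ ^ α : ℝ) := by
    rw [atsScale]; push_cast; rfl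
  have hc : lnL α t (k t) ((η t * (σ t) ^ 2 : ℝ) : ℂ) = (atsDrift α σ k η t : ℂ) := by
    have e := Complex.ofReal_cpow
      (by positivity : 0 ≤ 1 + η t * ((σ t) ^ 2 * k t) / (1 - α)) α
    rw [lnL, atsDrift, Complex.ofReal_mul _ (1 - _), Complex.ofReal_sub 1 (_ ^ _), e]
    push_cast
    ring_nf
  rw [atsCharFun, stableExponent, hc, hA, lnL, hbase, ofReal_mul_cpow hκ0 hw0, hB]
  congr 1
  push_cast
  ring

theorem atsLower_antitone (hpar : IsATSParameters α σ k η) :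
    AntitoneOn (atsLower α σ k η) (Set.Ioi 0) := by
  intro s hs t ht hst
  have := hpar.g₂_mono hs ht hst
  unfold g₂ at this
  unfold atsLower
  linarith

theorem atsUpper_antitone (hpar : IsATSParameters α σ k η) :
    AntitoneOn (atsUpper α σ k η) (Set.Ioi 0) := by
  intro s hs t ht hst
  have := hpar.g₁_mono hs ht hst
  unfold g₁ at this
  unfold atsUpper
  linarith

theorem atsLower_add_atsUpper :
    atsLower α σ k η t + atsUpper α σ k η t = 2 * atsRoot α σ k η t := by
  unfold atsLower atsUpper
  ring

/-- This turns the condition on `g₃` into one on the triple `(a, b, B)`: both sides are a constant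
depending on `α` times `t σ^(2α) k^(α-1) G^α`. -/
theorem atsScale_mul_rpow (hα0 : 0 < α) (hα1 : α < 1) (hpar : IsATSParameters α σ k η)
    (ht : 0 < t) :
    atsScale α σ k t * (atsLower α σ k η t + atsUpper α σ k η t) ^ α
      = (1 - α) / α * (1 / (1 - α)) ^ α * g₃ α σ k η t ^ α := by
  have hk := hpar.k_pos t ht
  have hσ := hpar.σ_pos t
  have h1 := sub_pos.2 hα1
  have ht' : (0 : ℝ) < t := ht
  have hG := atsRoot_pos hα1 hpar ht
  rw [atsLower_add_atsUpper, atsScale, g₃]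
  have e1 : ((t : ℝ) ^ (1 / α) * σ t ^ 2 / k t ^ ((1 - α) / α) * atsRoot α σ k η t) ^ α
      = t * (σ t ^ 2) ^ α / k t ^ (1 - α) * atsRoot α σ k η t ^ α := by
    rw [Real.mul_rpow (by positivity) hG.le, Real.div_rpow (by positivity) (by positivity),
      Real.mul_rpow (by positivity) (by positivity), ← Real.rpow_mul ht'.le,
      ← Real.rpow_mul hk.le, one_div_mul_cancel hα0.ne', div_mul_cancel₀ _ hα0.ne', Real.rpow_one]
  rw [e1, Real.div_rpow (by positivity) (by positivity), Real.mul_rpow (by positivity) hk.le,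
    Real.mul_rpow (by positivity) h1.le, Real.mul_rpow (by positivity) hG.le,
    Real.div_rpow zero_le_one h1.le, Real.one_rpow, Real.rpow_sub hk, Real.rpow_one]
  have := Real.rpow_pos_of_pos hk α
  have := Real.rpow_pos_of_pos h1 α
  field_simp

theorem atsScale_mul_rpow_le (hα0 : 0 < α) (hα1 : α < 1) (hpar : IsATSParameters α σ k η)
    {s : ℝ≥0} (hs : 0 < s) (hst : s ≤ t) :
    atsScale α σ k s * (atsLower α σ k η s + atsUpper α σ k η s) ^ α
      ≤ atsScale α σ k t * (atsLower α σ k η t + atsUpper α σ k η t) ^ α := by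
  have ht := hs.trans_le hst
  have h1 := sub_pos.2 hα1
  rw [atsScale_mul_rpow hα0 hα1 hpar hs, atsScale_mul_rpow hα0 hα1 hpar ht]
  have h0 : 0 ≤ g₃ α σ k η s := by
    have := hpar.k_pos s hs
    have := atsRoot_pos hα1 hpar hs
    unfold g₃
    positivity
  have := hpar.g₃_mono hs ht hst
  gcongr

/-- Two times with the same strip and the same scale have the same characteristic function. -/
theorem atsDrift_eq_of_eq (hα1 : α < 1) (hpar : IsATSParameters α σ k η)
    {s : ℝ≥0} (hs : 0 < s) (ht : 0 < t) (ha : atsLower α σ k η s = atsLower α σ k η t)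
    (hb : atsUpper α σ k η s = atsUpper α σ k η t) (hB : atsScale α σ k s = atsScale α σ k t) :
    atsDrift α σ k η s = atsDrift α σ k η t := by
  have h1 := sub_pos.2 hα1
  have hks := hpar.k_pos s hs
  have hkt := hpar.k_pos t ht
  have hσs := hpar.σ_pos s
  have hσt := hpar.σ_pos t
  -- The difference `a - b` recovers `η`, the product `ab` recovers `σ² k`, and then the scale
  -- recovers `t / k`.
  have hη : η s = η t := by
    unfold atsLower at ha
    unfold atsUpper at hb
    linarith
  have hκ : (σ s) ^ 2 * k s = (σ t) ^ 2 * k t := by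
    have h := atsLower_mul_atsUpper hα1 hpar hs
    rw [ha, hb, atsLower_mul_atsUpper hα1 hpar ht] at h
    have h2 : 2 * (1 - α) ≠ 0 := by positivity
    have h3 : 0 < (σ s) ^ 2 * k s := by positivity
    have h4 : 0 < (σ t) ^ 2 * k t := by positivity
    rw [div_eq_div_iff h4.ne' h3.ne'] at h
    exact mul_left_cancel₀ h2 h
  have hpos : 0 < ((σ t) ^ 2 * k t / (2 * (1 - α))) ^ α := by positivity
  have hr : (s : ℝ) / k s * ((1 - α) / α) = (t : ℝ) / k t * ((1 - α) / α) := by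
    unfold atsScale at hB
    rw [hκ] at hB
    exact mul_right_cancel₀ hpos.ne' hB
  rw [atsDrift, atsDrift, hr, hη, hκ]

/-- A weighted form of the monotonicity of the scale. -/
theorem eq_of_scale_le {α a b a' b' B B' : ℝ} (hα0 : 0 < α) (ha' : 0 < a') (hb' : 0 < b')
    (ha : a' ≤ a) (hb : b' ≤ b) (hB : 0 < B)
    (h : B * (a + b) ^ α ≤ B' * (a' + b') ^ α) :
    B < B' ∨ (a = a' ∧ b = b' ∧ B = B') := by
  have hpos : 0 < (a' + b') ^ α := by positivity
  have h2 : B * (a' + b') ^ α ≤ B' * (a' + b') ^ α := by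
    refine le_trans ?_ h
    gcongr
  have h3 : B ≤ B' := le_of_mul_le_mul_right h2 hpos
  rcases h3.lt_or_eq with h4 | h4
  · exact Or.inl h4
  · right
    rw [← h4] at h
    -- With equal scales the sums compare the other way, so both inequalities `a' ≤ a` and `b' ≤ b`
    -- are equalities.
    have h5 : (a + b) ^ α ≤ (a' + b') ^ α := le_of_mul_le_mul_left h hB
    have h6 : a + b ≤ a' + b' := (Real.rpow_le_rpow_iff (by linarith) (by linarith) hα0).1 h5
    exact ⟨by linarith, by linarith, h4⟩

end

/-! ### Increments of an additive process and their characteristic functions. -/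

section

variable {Ω : Type*} [MeasurableSpace Ω] {P : Measure Ω} [IsProbabilityMeasure P]
  {f : ℝ≥0 → Ω → ℝ}

theorem IsAdditiveProcess.charFun_law_mul (hf : IsAdditiveProcess P f) {s t : ℝ≥0} (hst : s ≤ t)
    (u : ℝ) : charFun (law P f s) u * charFun (incrementLaw P f s t) u = charFun (law P f t) u := by
  have hind : IndepFun (f s) (f t - f s) P :=
    hf.indep_increments.indepFun_eval_sub zero_le hst hf.start_zero
  have h := hind.charFun_map_add_eq_mul (hf.measurable s).aemeasurable
    ((hf.measurable t).sub (hf.measurable s)).aemeasurable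
  have e : f s + (f t - f s) = f t := by
    ext ω
    simp
  rw [e] at h
  exact (congrFun h u).symm

/-- Dividing in `charFun_law_mul` shows that the increment has characteristic function `1`, so its
law is the Dirac mass at `0`. -/
theorem IsAdditiveProcess.ae_eq_of_charFun_eq (hf : IsAdditiveProcess P f) {s t : ℝ≥0}
    (hst : s ≤ t) (hne : ∀ u, charFun (law P f s) u ≠ 0)
    (heq : ∀ u, charFun (law P f s) u = charFun (law P f t) u) : f t =ᵐ[P] f s := by
  have hm : Measurable (fun ω => f t ω - f s ω) := (hf.measurable t).sub (hf.measurable s)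
  have : IsProbabilityMeasure (incrementLaw P f s t) := Measure.isProbabilityMeasure_map hm.aemeasurable
  have h1 : incrementLaw P f s t = Measure.dirac 0 := by
    refine Measure.ext_of_charFun (funext fun u => ?_)
    have h := hf.charFun_law_mul hst u
    rw [← heq u] at h
    have := mul_left_cancel₀ (hne u) (h.trans (mul_one _).symm)
    rw [this]
    simp
  have h2 : ∀ᵐ x ∂(incrementLaw P f s t), x = 0 := by
    rw [h1]
    simp
  have h3 := ae_of_ae_map hm.aemeasurable h2
  filter_upwards [h3] with ω hω
  linarith

end

/-! ### Strict growth of the scale, and the values of `pPlus` and `pMinus`. -/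

section

variable {Ω : Type*} [MeasurableSpace Ω] {P : Measure Ω} {α : ℝ} {σ k η : ℝ≥0 → ℝ} {f : ℝ≥0 → Ω → ℝ}

theorem IsATSProcess.charFun_law_zero (hf : IsATSProcess P α σ k η f) (u : ℝ) :
    charFun (law P f 0) u = 1 := by
  rw [hf.charFun_eq, atsCharFun_zero]

theorem IsATSProcess.charFun_law_pos (hα0 : 0 < α) (hα1 : α < 1)
    (hpar : IsATSParameters α σ k η) (hf : IsATSProcess P α σ k η f) {t : ℝ≥0} (ht : 0 < t)
    (u : ℝ) : charFun (law P f t) u = Complex.exp (stableExponent α (atsLower α σ k η t)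
      (atsUpper α σ k η t) (atsScale α σ k t) (atsDrift α σ k η t) u) := by
  rw [hf.charFun_eq, atsCharFun_eq_exp hα0 hα1 hpar ht]

/-- The nontriviality of the increments enters only here: an equality of scales forces equal laws.
At `s = 0` the scale is `0` and there is nothing to exclude. -/
theorem IsATSProcess.atsScale_lt [IsProbabilityMeasure P] (hα0 : 0 < α) (hα1 : α < 1)
    (hpar : IsATSParameters α σ k η) (hf : IsATSProcess P α σ k η f)
    (hnd : ∀ s t : ℝ≥0, s < t → ¬ (f t =ᵐ[P] f s)) {s t : ℝ≥0} (hst : s < t) :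
    atsScale α σ k s < atsScale α σ k t := by
  have ht : 0 < t := (zero_le (a := s)).trans_lt hst
  rcases (zero_le (a := s)).eq_or_lt with rfl | hs
  · rw [atsScale_zero]
    exact atsScale_pos hα0 hα1 hpar ht
  · rcases eq_of_scale_le hα0 (zero_lt_one.trans (one_lt_atsLower hα1 hpar ht))
      (atsUpper_pos hα1 hpar ht) (atsLower_antitone hpar hs ht hst.le)
      (atsUpper_antitone hpar hs ht hst.le) (atsScale_pos hα0 hα1 hpar hs)
      (atsScale_mul_rpow_le hα0 hα1 hpar hs hst.le) with h | ⟨ha, hb, hB⟩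
    · exact h
    · have hc := atsDrift_eq_of_eq hα1 hpar hs ht ha hb hB
      refine absurd (hf.additive.ae_eq_of_charFun_eq hst.le (fun u => ?_) fun u => ?_) (hnd s t hst)
      · rw [hf.charFun_law_pos hα0 hα1 hpar hs]
        exact Complex.exp_ne_zero _
      · rw [hf.charFun_law_pos hα0 hα1 hpar hs, hf.charFun_law_pos hα0 hα1 hpar ht, ha, hb, hB, hc]

theorem IsATSProcess.pMinus_zero (hf : IsATSProcess P α σ k η f) : pMinus P f 0 = ⊤ :=
  stripUpper_of_charFun_eq_one hf.charFun_law_zero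

theorem IsATSProcess.pPlus_zero (hf : IsATSProcess P α σ k η f) : pPlus P f 0 = ⊤ := by
  rw [pPlus, stripLower_of_charFun_eq_one hf.charFun_law_zero, EReal.neg_bot]
  exact EReal.top_sub_coe 1

theorem IsATSProcess.pMinus_pos (hα0 : 0 < α) (hα1 : α < 1) (hpar : IsATSParameters α σ k η)
    (hf : IsATSProcess P α σ k η f) {t : ℝ≥0} (ht : 0 < t) :
    pMinus P f t = (atsUpper α σ k η t : ℝ) :=
  stripUpper_stable hα0 hα1 (zero_lt_one.trans (one_lt_atsLower hα1 hpar ht))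
    (atsUpper_pos hα1 hpar ht) (atsScale_pos hα0 hα1 hpar ht)
    (hf.charFun_law_pos hα0 hα1 hpar ht)

theorem IsATSProcess.pPlus_pos (hα0 : 0 < α) (hα1 : α < 1) (hpar : IsATSParameters α σ k η)
    (hf : IsATSProcess P α σ k η f) {t : ℝ≥0} (ht : 0 < t) :
    pPlus P f t = ((atsLower α σ k η t - 1 : ℝ) : EReal) := by
  rw [pPlus, stripLower_stable hα0 hα1 (zero_lt_one.trans (one_lt_atsLower hα1 hpar ht))
    (atsUpper_pos hα1 hpar ht) (atsScale_pos hα0 hα1 hpar ht)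
    (hf.charFun_law_pos hα0 hα1 hpar ht), EReal.coe_neg, neg_neg, EReal.coe_sub, EReal.coe_one]

theorem IsATSProcess.stripNonincreasing (hα0 : 0 < α) (hα1 : α < 1)
    (hpar : IsATSParameters α σ k η) (hf : IsATSProcess P α σ k η f) :
    StripNonincreasing P f := by
  constructor
  · intro s t hst
    rcases (zero_le (a := s)).eq_or_lt with rfl | hs
    · rw [hf.pPlus_zero]
      exact le_top
    · have ht := hs.trans_le hst
      rw [hf.pPlus_pos hα0 hα1 hpar hs, hf.pPlus_pos hα0 hα1 hpar ht, EReal.coe_le_coe_iff]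
      linarith [atsLower_antitone hpar hs ht hst]
  · intro s t hst
    rcases (zero_le (a := s)).eq_or_lt with rfl | hs
    · rw [hf.pMinus_zero]
      exact le_top
    · have ht := hs.trans_le hst
      rw [hf.pMinus_pos hα0 hα1 hpar hs, hf.pMinus_pos hα0 hα1 hpar ht, EReal.coe_le_coe_iff]
      exact atsUpper_antitone hpar hs ht hst

theorem IsATSProcess.strip_pos (hα0 : 0 < α) (hα1 : α < 1)
    (hpar : IsATSParameters α σ k η) (hf : IsATSProcess P α σ k η f) (t : ℝ≥0) :
    0 < pPlus P f t ∧ 0 < pMinus P f t := by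
  rcases (zero_le (a := t)).eq_or_lt with rfl | ht
  · rw [hf.pPlus_zero, hf.pMinus_zero]
    exact ⟨EReal.zero_lt_top, EReal.zero_lt_top⟩
  · rw [hf.pPlus_pos hα0 hα1 hpar ht, hf.pMinus_pos hα0 hα1 hpar ht]
    exact ⟨EReal.coe_pos.2 (sub_pos.2 (one_lt_atsLower hα1 hpar ht)),
      EReal.coe_pos.2 (atsUpper_pos hα1 hpar ht)⟩

theorem IsATSProcess.pPlus_sub_pMinus (hα0 : 0 < α) (hα1 : α < 1)
    (hpar : IsATSParameters α σ k η) (hf : IsATSProcess P α σ k η f) {t : ℝ≥0} (ht : 0 < t) :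
    pPlus P f t - pMinus P f t = ((2 * η t : ℝ) : EReal) := by
  rw [hf.pPlus_pos hα0 hα1 hpar ht, hf.pMinus_pos hα0 hα1 hpar ht, ← EReal.coe_sub,
    atsLower, atsUpper]
  congr 1
  ring

theorem IsATSProcess.pMinus_le_pPlus (hα0 : 0 < α) (hα1 : α < 1)
    (hpar : IsATSParameters α σ k η) (hf : IsATSProcess P α σ k η f) (t : ℝ≥0) :
    pMinus P f t ≤ pPlus P f t := by
  rcases (zero_le (a := t)).eq_or_lt with rfl | ht
  · rw [hf.pPlus_zero, hf.pMinus_zero]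
  · rw [hf.pPlus_pos hα0 hα1 hpar ht, hf.pMinus_pos hα0 hα1 hpar ht, EReal.coe_le_coe_iff,
      atsLower, atsUpper]
    linarith [hpar.η_nonneg t ht]

end

/-! ### A Stieltjes integral for complex powers -/

section

variable {α : ℝ}

/-- Write `1 / (l + x) = ∫ exp (-s (l + x)) ds` and exchange the integrals; each of the two
integrations is a Gamma integral. -/
theorem integrableOn_rpow_div_add_real (hα0 : 0 < α) (hα1 : α < 1) {x : ℝ} (hx : 0 < x) :
    IntegrableOn (fun l : ℝ => l ^ (α - 1) / (l + x)) (Set.Ioi 0) ∧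
      ∫ l in Set.Ioi (0 : ℝ), l ^ (α - 1) / (l + x)
        = Real.Gamma α * Real.Gamma (1 - α) * x ^ (α - 1) := by
  have h1 := sub_pos.2 hα1
  have hl : ∀ s ∈ Set.Ioi (0 : ℝ), ∫ l in Set.Ioi (0 : ℝ), l ^ (α - 1) * Real.exp (-(s * l))
      = (1 / s) ^ α * Real.Gamma α := fun s hs => Real.integral_rpow_mul_exp_neg_mul_Ioi hα0 hs
  have hs' : ∫ s in Set.Ioi (0 : ℝ), s ^ (1 - α - 1) * Real.exp (-(x * s))
      = (1 / x) ^ (1 - α) * Real.Gamma (1 - α) := Real.integral_rpow_mul_exp_neg_mul_Ioi h1 hx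
  have hx1 : (1 / x) ^ (1 - α) = x ^ (α - 1) := by
    rw [one_div, Real.inv_rpow hx.le, ← Real.rpow_neg hx.le, neg_sub]
  let f : ℝ × ℝ → ℝ := fun p => p.2 ^ (α - 1) * Real.exp (-(p.1 * p.2)) * Real.exp (-(x * p.1))
  have hf : Measurable f := by fun_prop
  have hinner : ∀ s ∈ Set.Ioi (0 : ℝ), ∫ l in Set.Ioi (0 : ℝ), f (s, l)
      = Real.Gamma α * (s ^ (1 - α - 1) * Real.exp (-(x * s))) := by
    intro s hs
    have hs0 : 0 < s := hs
    have e : s ^ (1 - α - 1) = (1 / s) ^ α := by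
      rw [one_div, Real.inv_rpow hs0.le, ← Real.rpow_neg hs0.le]
      ring_nf
    simp only [f]
    rw [integral_mul_const, hl s hs, e]
    ring
  have hint : Integrable f ((volume.restrict (Set.Ioi 0)).prod (volume.restrict (Set.Ioi 0))) := by
    rw [integrable_prod_iff hf.aestronglyMeasurable]
    constructor
    · filter_upwards [self_mem_ae_restrict measurableSet_Ioi] with s hs
      have hs0 : (0 : ℝ) < s := hs
      have h : Integrable (fun l => l ^ (α - 1) * Real.exp (-(s * l)))
          (volume.restrict (Set.Ioi 0)) := by
        -- A non-integrable function has integral `0` by convention, so a nonzero value proves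
        -- integrability.
        refine Integrable.of_integral_ne_zero ?_
        rw [hl s hs]
        positivity
      exact h.mul_const (Real.exp (-(x * s)))
    · have h : Integrable (fun s => Real.Gamma α * (s ^ (1 - α - 1) * Real.exp (-(x * s))))
          (volume.restrict (Set.Ioi 0)) := by
        refine (Integrable.of_integral_ne_zero ?_).const_mul _
        rw [hs']
        positivity
      refine h.congr ?_
      filter_upwards [self_mem_ae_restrict measurableSet_Ioi] with s hs
      rw [← hinner s hs]
      refine setIntegral_congr_fun measurableSet_Ioi fun l hl => ?_
      have : (0 : ℝ) < l := hl
      exact (abs_of_nonneg (by positivity)).symm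
  have houter : ∀ l ∈ Set.Ioi (0 : ℝ), ∫ s in Set.Ioi (0 : ℝ), f (s, l)
      = l ^ (α - 1) / (l + x) := by
    intro l hl
    have hl0 : (0 : ℝ) < l := hl
    have e : ∀ s, f (s, l) = l ^ (α - 1) * Real.exp (-(l + x) * s) := by
      intro s
      simp only [f]
      rw [mul_assoc, ← Real.exp_add]
      ring_nf
    simp_rw [e]
    rw [integral_const_mul, integral_exp_mul_Ioi (by linarith) 0]
    rw [mul_zero, Real.exp_zero, neg_div_neg_eq, mul_one_div]
  constructor
  · refine hint.integral_prod_right.congr ?_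
    filter_upwards [self_mem_ae_restrict measurableSet_Ioi] with l hl using houter l hl
  · rw [← setIntegral_congr_fun measurableSet_Ioi houter,
      ← integral_integral_swap (f := fun s l => f (s, l)) hint,
      setIntegral_congr_fun measurableSet_Ioi hinner, integral_const_mul, hs', hx1]
    ring

theorem le_norm_ofReal_add {z : ℂ} {l c : ℝ} (hz : c ≤ z.re) :
    l + c ≤ ‖(l : ℂ) + z‖ := by
  refine le_trans ?_ (Complex.re_le_norm _)
  simpa using hz

theorem ofReal_add_ne_zero {z : ℂ} {l : ℝ} (hl : 0 < l) (hz : 0 < z.re) : (l : ℂ) + z ≠ 0 := by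
  have := le_norm_ofReal_add (z := z) (l := l) le_rfl
  rw [← norm_pos_iff]
  linarith

theorem integrableOn_rpow_div_add (hα0 : 0 < α) (hα1 : α < 1) {z : ℂ} (hz : 0 < z.re) :
    IntegrableOn (fun l : ℝ => ((l ^ (α - 1) : ℝ) : ℂ) / (l + z)) (Set.Ioi 0) := by
  refine Integrable.mono' (integrableOn_rpow_div_add_real hα0 hα1 hz).1
    (Measurable.aestronglyMeasurable (by fun_prop)) ?_
  filter_upwards [self_mem_ae_restrict measurableSet_Ioi] with l hl
  have hl0 : (0 : ℝ) < l := hl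
  rw [norm_div, Complex.norm_real, Real.norm_of_nonneg (by positivity)]
  gcongr
  exact le_norm_ofReal_add le_rfl

/-- Both sides are holomorphic on the right half-plane and agree on the positive reals, so the
identity theorem applies. -/
theorem integral_rpow_div_add (hα0 : 0 < α) (hα1 : α < 1) {z : ℂ} (hz : 0 < z.re) :
    ∫ l in Set.Ioi (0 : ℝ), ((l ^ (α - 1) : ℝ) : ℂ) / (l + z)
      = (Real.Gamma α * Real.Gamma (1 - α) : ℝ) * z ^ ((α : ℂ) - 1) := by
  have hopen : IsOpen {z : ℂ | 0 < z.re} := isOpen_lt continuous_const Complex.continuous_re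
  have hconv : Convex ℝ {z : ℂ | 0 < z.re} := convex_halfSpace_re_gt 0
  have hd : DifferentiableOn ℂ
      (fun z : ℂ => ∫ l in Set.Ioi (0 : ℝ), ((l ^ (α - 1) : ℝ) : ℂ) / (l + z)) {z | 0 < z.re} := by
    intro w hw
    have hw0 : 0 < w.re := hw
    -- On `Re z > c` one has `|l + z| ≥ l + c ≥ c`, which dominates the `z`-derivative of the
    -- integrand by `l^(α-1) / ((l + c) c)`.
    set c := w.re / 2 with hc
    have hc0 : 0 < c := by positivity
    have hs : {z : ℂ | c < z.re} ∈ 𝓝 w :=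
      (isOpen_lt continuous_const Complex.continuous_re).mem_nhds (by
        change w.re / 2 < w.re
        linarith)
    refine (hasDerivAt_integral_of_dominated_loc_of_deriv_le
      (F := fun (z : ℂ) (l : ℝ) => ((l ^ (α - 1) : ℝ) : ℂ) / (l + z))
      (F' := fun (z : ℂ) (l : ℝ) => -((l ^ (α - 1) : ℝ) : ℂ) / (l + z) ^ 2)
      (bound := fun l => l ^ (α - 1) / (l + c) * c⁻¹) hs
      (Eventually.of_forall fun z => ?_) (integrableOn_rpow_div_add hα0 hα1 hw0) ?_ ?_
      ((integrableOn_rpow_div_add_real hα0 hα1 hc0).1.mul_const _) ?_).2.differentiableAt.differentiableWithinAt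
    · exact Measurable.aestronglyMeasurable (by fun_prop)
    · exact Measurable.aestronglyMeasurable (by fun_prop)
    · filter_upwards [self_mem_ae_restrict measurableSet_Ioi] with l hl v hv
      have hl0 : (0 : ℝ) < l := hl
      have hb := le_norm_ofReal_add (l := l) (le_of_lt hv)
      rw [norm_div, norm_neg, Complex.norm_real, Real.norm_of_nonneg (by positivity), norm_pow,
        ← div_eq_mul_inv, div_div]
      gcongr
      nlinarith
    · filter_upwards [self_mem_ae_restrict measurableSet_Ioi] with l hl v hv
      have hne : (l : ℂ) + v ≠ 0 := ofReal_add_ne_zero hl (hc0.trans hv)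
      have h := ((hasDerivAt_id v).const_add (l : ℂ)).fun_inv hne
      have h2 := h.const_mul ((l ^ (α - 1) : ℝ) : ℂ)
      convert! h2 using 1
      simp only [id]
      ring
  have hd2 : DifferentiableOn ℂ
      (fun z : ℂ => ((Real.Gamma α * Real.Gamma (1 - α) : ℝ) : ℂ) * z ^ ((α : ℂ) - 1))
      {z | 0 < z.re} := by
    intro w hw
    exact ((differentiableAt_id.cpow (differentiableAt_const _) (Or.inl hw)).const_mul
      _).differentiableWithinAt
  refine AnalyticOnNhd.eqOn_of_preconnected_of_frequently_eq (hd.analyticOnNhd hopen)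
    (hd2.analyticOnNhd hopen) hconv.isPreconnected
    (z₀ := 1) (by simp) ?_ hz
  have ht : Tendsto (fun x : ℝ => (x : ℂ)) (𝓝[≠] 1) (𝓝[≠] 1) := by
    refine tendsto_nhdsWithin_of_tendsto_nhds_of_eventually_within _ ?_ ?_
    · exact (Complex.continuous_ofReal.tendsto' 1 1 (by simp)).mono_left nhdsWithin_le_nhds
    · filter_upwards [self_mem_nhdsWithin] with x hx
      simpa using hx
  have hpos : ∀ᶠ x : ℝ in 𝓝[≠] 1, 0 < x := nhdsWithin_le_nhds (lt_mem_nhds zero_lt_one)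
  refine ht.frequently (Eventually.frequently ?_)
  filter_upwards [hpos] with x hx
  have e : ∀ l : ℝ, ((l ^ (α - 1) : ℝ) : ℂ) / (l + x) = ((l ^ (α - 1) / (l + x) : ℝ) : ℂ) := by
    intro l
    push_cast
    rfl
  simp_rw [e]
  rw [integral_complex_ofReal, (integrableOn_rpow_div_add_real hα0 hα1 hx).2, Complex.ofReal_mul,
    Complex.ofReal_cpow hx.le]
  push_cast
  rfl

/-- Each term alone behaves like `l^(α-1)` at infinity and is not integrable. Since `l / (l + z) = 1
- z / (l + z)`, the divergent parts cancel in the difference. -/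
theorem integrableOn_rpow_mul_inv_sub_inv (hα0 : 0 < α) (hα1 : α < 1) {z w : ℂ} (hz : 0 < z.re)
    (hw : 0 < w.re) :
    IntegrableOn (fun l : ℝ => ((l ^ α : ℝ) : ℂ) * (1 / (l + w) - 1 / (l + z))) (Set.Ioi 0) ∧
    ∫ l in Set.Ioi (0 : ℝ), ((l ^ α : ℝ) : ℂ) * (1 / (l + w) - 1 / (l + z))
      = (Real.Gamma α * Real.Gamma (1 - α) : ℝ) * (z ^ (α : ℂ) - w ^ (α : ℂ)) := by
  have hcongr : ∀ l ∈ Set.Ioi (0 : ℝ), ((l ^ α : ℝ) : ℂ) * (1 / (l + w) - 1 / (l + z))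
      = z * (((l ^ (α - 1) : ℝ) : ℂ) / (l + z)) - w * (((l ^ (α - 1) : ℝ) : ℂ) / (l + w)) := by
    intro l hl
    have hl0 : (0 : ℝ) < l := hl
    have h1 := ofReal_add_ne_zero hl0 hz
    have h2 := ofReal_add_ne_zero hl0 hw
    have e : ((l ^ α : ℝ) : ℂ) = ((l ^ (α - 1) : ℝ) : ℂ) * l := by
      rw [← Complex.ofReal_mul, Real.rpow_sub_one hl0.ne', div_mul_cancel₀ _ hl0.ne']
    rw [e]
    field_simp
    ring
  have i1 := (integrableOn_rpow_div_add hα0 hα1 hz).const_mul z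
  have i2 := (integrableOn_rpow_div_add hα0 hα1 hw).const_mul w
  have hp : ∀ v : ℂ, 0 < v.re → v * v ^ ((α : ℂ) - 1) = v ^ (α : ℂ) := by
    intro v hv
    have hv0 : v ≠ 0 := by
      rintro rfl
      simp at hv
    rw [Complex.cpow_sub _ _ hv0, Complex.cpow_one, mul_div_cancel₀ _ hv0]
  constructor
  · exact (integrableOn_congr_fun hcongr measurableSet_Ioi).2 (i1.sub i2)
  · rw [setIntegral_congr_fun measurableSet_Ioi hcongr, integral_sub i1 i2, integral_const_mul,
      integral_const_mul, integral_rpow_div_add hα0 hα1 hz, integral_rpow_div_add hα0 hα1 hw,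
      ← hp z hz, ← hp w hw]
    ring

theorem integrableOn_rpow_div_sq (hα0 : 0 < α) (hα1 : α < 1) {c : ℝ} (hc : 0 < c) :
    IntegrableOn (fun l : ℝ => ((l ^ α : ℝ) : ℂ) * (1 / (l + c) ^ 2)) (Set.Ioi 0) := by
  refine Integrable.mono' (integrableOn_rpow_div_add_real hα0 hα1 hc).1
    (Measurable.aestronglyMeasurable (by fun_prop)) ?_
  filter_upwards [self_mem_ae_restrict measurableSet_Ioi] with l hl
  have hl0 : (0 : ℝ) < l := hl
  have e : ((l ^ α : ℝ) : ℂ) * (1 / (l + c) ^ 2) = ((l ^ α * (1 / (l + c) ^ 2) : ℝ) : ℂ) := by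
    push_cast
    rfl
  rw [e, Complex.norm_real, Real.norm_of_nonneg (by positivity), Real.rpow_sub_one hl0.ne',
    div_div, mul_one_div]
  gcongr
  nlinarith

end

/-! ### Two-sided mixtures of exponentials and the Lévy-Khintchine formula -/

/-- The mixture `∫_G^∞ (w² - G²) ^ α exp (-w |x| - θ x) dw` of two-sided exponentials. -/
noncomputable def expMixture (α G θ x : ℝ) : ℝ :=
  ∫ w in Set.Ioi G, (w ^ 2 - G ^ 2) ^ α * Real.exp (-(w * |x|) - θ * x)

section

theorem integrableOn_exp_neg_mul {q : ℂ} (hq : 0 < q.re) :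
    IntegrableOn (fun x : ℝ => Complex.exp (-q * x)) (Set.Ioi 0) :=
  integrableOn_exp_mul_complex_Ioi (by simpa using hq) 0

theorem integral_exp_neg_mul {q : ℂ} (hq : 0 < q.re) :
    ∫ x in Set.Ioi (0 : ℝ), Complex.exp (-q * x) = 1 / q := by
  rw [integral_exp_mul_complex_Ioi (by simpa using hq)]
  simp

theorem integral_pow_mul_exp_neg_mul {q : ℝ} (hq : 0 < q) (n : ℕ) :
    IntegrableOn (fun x : ℝ => x ^ n * Real.exp (-(q * x))) (Set.Ioi 0) ∧
      ∫ x in Set.Ioi (0 : ℝ), x ^ n * Real.exp (-(q * x)) = n.factorial / q ^ (n + 1) := by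
  have h := Real.integral_rpow_mul_exp_neg_mul_Ioi (a := n + 1) (by positivity) hq
  have e : ∀ x : ℝ, x ^ ((n : ℝ) + 1 - 1) = x ^ n := by
    intro x
    rw [add_sub_cancel_right, Real.rpow_natCast]
  simp_rw [e] at h
  rw [Real.Gamma_nat_eq_factorial] at h
  have h2 : (1 / q) ^ ((n : ℝ) + 1) = 1 / q ^ (n + 1) := by
    rw [← Nat.cast_add_one, Real.rpow_natCast, div_pow, one_pow]
  rw [h2] at h
  refine ⟨Integrable.of_integral_ne_zero ?_, ?_⟩
  · rw [h]
    positivity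
  · rw [h]
    ring

/-- Splitting an integral over the line at the origin. -/
theorem integral_eq_add_neg {E : Type*} [NormedAddCommGroup E] [NormedSpace ℝ E] {f : ℝ → E}
    (h1 : IntegrableOn f (Set.Ioi 0))
    (h2 : IntegrableOn (fun x => f (-x)) (Set.Ioi 0)) :
    Integrable f ∧
      ∫ x, f x = (∫ x in Set.Ioi 0, f x) + ∫ x in Set.Ioi 0, f (-x) := by
  have h3 : IntegrableOn f (Set.Iic 0) := by
    rw [integrableOn_Iic_iff_integrableOn_Iio]
    have h := (Measure.measurePreserving_neg (volume : Measure ℝ)).integrableOn_comp_preimage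
      (Homeomorph.neg ℝ).measurableEmbedding (f := f) (s := Set.Iio 0)
    rw [show (Neg.neg ⁻¹' Set.Iio (0 : ℝ)) = Set.Ioi 0 by ext; simp] at h
    exact h.1 h2
  have hi : Integrable f := by
    rw [← integrableOn_univ, ← Set.Iic_union_Ioi (a := (0 : ℝ))]
    exact h3.union h1
  refine ⟨hi, ?_⟩
  rw [integral_comp_neg_Ioi (c := 0), neg_zero, add_comm, intervalIntegral.integral_Iic_add_Ioi h3 h1]

/-- The Laplace transform of the compensated exponential on the half-line. -/
theorem integral_compensated_mul_exp {q : ℝ} (hq : 0 < q) (u : ℝ) :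
    IntegrableOn (fun x : ℝ => (Complex.exp (Complex.I * u * x) - 1 - Complex.I * u * x)
        * (Real.exp (-(q * x)) : ℝ)) (Set.Ioi 0) ∧
      ∫ x in Set.Ioi (0 : ℝ), (Complex.exp (Complex.I * u * x) - 1 - Complex.I * u * x)
        * (Real.exp (-(q * x)) : ℝ) = 1 / (q - Complex.I * u) - 1 / q - Complex.I * u / q ^ 2 := by
  have hq1 : 0 < ((q : ℂ) - Complex.I * u).re := by simpa using hq
  have hq2 : 0 < (q : ℂ).re := by simpa using hq
  have i1 := integrableOn_exp_neg_mul hq1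
  have i2 := integrableOn_exp_neg_mul hq2
  obtain ⟨i3, v3⟩ := integral_pow_mul_exp_neg_mul hq 1
  have i3' : IntegrableOn (fun x : ℝ => Complex.I * u * ((x ^ 1 * Real.exp (-(q * x)) : ℝ) : ℂ))
      (Set.Ioi 0) := (Integrable.ofReal i3).const_mul _
  have e : (fun x : ℝ => (Complex.exp (Complex.I * u * x) - 1 - Complex.I * u * x)
      * (Real.exp (-(q * x)) : ℝ)) = fun x : ℝ => Complex.exp (-((q : ℂ) - Complex.I * u) * x)
        - Complex.exp (-(q : ℂ) * x)
        - Complex.I * u * ((x ^ 1 * Real.exp (-(q * x)) : ℝ) : ℂ) := by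
    ext x
    have : -((q : ℂ) - Complex.I * u) * x = Complex.I * u * x + -(q * x) := by ring
    rw [this, Complex.exp_add]
    push_cast
    ring_nf
  have i12 : IntegrableOn (fun x : ℝ => Complex.exp (-((q : ℂ) - Complex.I * u) * x)
        - Complex.exp (-(q : ℂ) * x)) (Set.Ioi 0) := i1.sub i2
  rw [e]
  refine ⟨i12.sub i3', ?_⟩
  rw [integral_sub i12 i3', integral_sub i1 i2, integral_exp_neg_mul hq1,
    integral_exp_neg_mul hq2, integral_const_mul, integral_complex_ofReal, v3]
  push_cast
  simp
  ring

theorem integral_compensated_mul_two_sided {w θ : ℝ} (h1 : 0 < w + θ) (h2 : 0 < w - θ) (u : ℝ) :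
    ∫ x : ℝ, (Complex.exp (Complex.I * u * x) - 1 - Complex.I * u * x)
        * (Real.exp (-(w * |x|) - θ * x) : ℝ)
      = (1 / ((w + θ : ℝ) - Complex.I * u) - 1 / (w + θ : ℝ) - Complex.I * u / (w + θ : ℝ) ^ 2)
      + (1 / ((w - θ : ℝ) + Complex.I * u) - 1 / (w - θ : ℝ) + Complex.I * u / (w - θ : ℝ) ^ 2) := by
  obtain ⟨i1, v1⟩ := integral_compensated_mul_exp h1 u
  obtain ⟨i2, v2⟩ := integral_compensated_mul_exp h2 (-u)
  have e1 : Set.EqOn (fun x : ℝ => (Complex.exp (Complex.I * u * x) - 1 - Complex.I * u * x)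
        * (Real.exp (-(w * |x|) - θ * x) : ℝ))
      (fun x : ℝ => (Complex.exp (Complex.I * u * x) - 1 - Complex.I * u * x)
        * (Real.exp (-((w + θ) * x)) : ℝ)) (Set.Ioi 0) := by
    intro x hx
    simp only
    rw [abs_of_pos hx]
    ring_nf
  have e2 : Set.EqOn (fun x : ℝ => (Complex.exp (Complex.I * u * (-x : ℝ)) - 1
        - Complex.I * u * (-x : ℝ)) * (Real.exp (-(w * |-x|) - θ * -x) : ℝ))
      (fun x : ℝ => (Complex.exp (Complex.I * (-u : ℝ) * x) - 1 - Complex.I * (-u : ℝ) * x)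
        * (Real.exp (-((w - θ) * x)) : ℝ)) (Set.Ioi 0) := by
    intro x hx
    simp only
    rw [abs_neg, abs_of_pos hx]
    push_cast
    ring_nf
  rw [(integral_eq_add_neg ((integrableOn_congr_fun e1 measurableSet_Ioi).2 i1)
    ((integrableOn_congr_fun e2 measurableSet_Ioi).2 i2)).2,
    setIntegral_congr_fun measurableSet_Ioi e1, setIntegral_congr_fun measurableSet_Ioi e2, v1, v2]
  push_cast
  ring

theorem integral_sq_mul_two_sided {w θ : ℝ} (h1 : 0 < w + θ) (h2 : 0 < w - θ) :
    Integrable (fun x : ℝ => x ^ 2 * Real.exp (-(w * |x|) - θ * x)) ∧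
    ∫ x : ℝ, x ^ 2 * Real.exp (-(w * |x|) - θ * x) = 2 / (w + θ) ^ 3 + 2 / (w - θ) ^ 3 := by
  obtain ⟨i1, v1⟩ := integral_pow_mul_exp_neg_mul h1 2
  obtain ⟨i2, v2⟩ := integral_pow_mul_exp_neg_mul h2 2
  have e1 : Set.EqOn (fun x : ℝ => x ^ 2 * Real.exp (-(w * |x|) - θ * x))
      (fun x : ℝ => x ^ 2 * Real.exp (-((w + θ) * x))) (Set.Ioi 0) := by
    intro x hx
    simp only
    rw [abs_of_pos hx]
    ring_nf
  have e2 : Set.EqOn (fun x : ℝ => (-x) ^ 2 * Real.exp (-(w * |-x|) - θ * -x))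
      (fun x : ℝ => x ^ 2 * Real.exp (-((w - θ) * x))) (Set.Ioi 0) := by
    intro x hx
    simp only
    rw [abs_neg, abs_of_pos hx]
    ring_nf
  obtain ⟨i, v⟩ := integral_eq_add_neg
    ((integrableOn_congr_fun e1 measurableSet_Ioi).2 i1)
    ((integrableOn_congr_fun e2 measurableSet_Ioi).2 i2)
  refine ⟨i, ?_⟩
  rw [v, setIntegral_congr_fun measurableSet_Ioi e1, setIntegral_congr_fun measurableSet_Ioi e2,
    v1, v2]
  simp

end

section

variable {α G θ : ℝ}

theorem measurable_mixture_kernel :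
    Measurable fun p : ℝ × ℝ =>
      (p.1 ^ 2 - G ^ 2) ^ α * Real.exp (-(p.1 * |p.2|) - θ * p.2) := by
  have : Measurable fun p : ℝ × ℝ => |p.2| := measurable_snd.norm
  fun_prop

/-- This licenses every exchange of integrals below. The integral in `x` is of order `w^(2α - 3)`,
which is integrable at infinity because `α < 1`. -/
theorem integrable_sq_mul_mixture_kernel (hα0 : 0 < α) (hα1 : α < 1) (hG : |θ| < G) :
    Integrable (fun p : ℝ × ℝ => p.2 ^ 2 *
      ((p.1 ^ 2 - G ^ 2) ^ α * Real.exp (-(p.1 * |p.2|) - θ * p.2)))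
      ((volume.restrict (Set.Ioi G)).prod volume) := by
  have hG0 : 0 < G := (abs_nonneg θ).trans_lt hG
  have hθ := abs_lt.1 hG
  have hw : ∀ w ∈ Set.Ioi G, 0 < w + θ ∧ 0 < w - θ ∧ 0 ≤ w ^ 2 - G ^ 2 := by
    intro w hw
    have : G < w := hw
    refine ⟨by linarith, by linarith, by nlinarith⟩
  have hmeas : Measurable (fun p : ℝ × ℝ => p.2 ^ 2 *
      ((p.1 ^ 2 - G ^ 2) ^ α * Real.exp (-(p.1 * |p.2|) - θ * p.2))) :=
    (measurable_snd.pow_const 2).mul measurable_mixture_kernel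
  have e : ∀ w x : ℝ, x ^ 2 * ((w ^ 2 - G ^ 2) ^ α * Real.exp (-(w * |x|) - θ * x))
      = (w ^ 2 - G ^ 2) ^ α * (x ^ 2 * Real.exp (-(w * |x|) - θ * x)) := fun w x => by ring
  rw [integrable_prod_iff hmeas.aestronglyMeasurable]
  constructor
  · filter_upwards [self_mem_ae_restrict measurableSet_Ioi] with w hw'
    obtain ⟨h1, h2, h3⟩ := hw w hw'
    simp_rw [e]
    exact (integral_sq_mul_two_sided h1 h2).1.const_mul _
  -- This `c` gives `w ± θ ≥ c w` for all `w > G`.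
  · set c := 1 - |θ| / G with hc
    have hc0 : 0 < c := by
      rw [hc, sub_pos, div_lt_one hG0]
      exact hG
    have hb : IntegrableOn (fun w : ℝ => 4 / c ^ 3 * w ^ (2 * α - 3)) (Set.Ioi G) :=
      (integrableOn_Ioi_rpow_of_lt (by linarith) hG0).const_mul _
    refine Integrable.mono' hb ?_ ?_
    · exact (hmeas.norm.stronglyMeasurable.integral_prod_right).aestronglyMeasurable
    · filter_upwards [self_mem_ae_restrict measurableSet_Ioi] with w hw'
      obtain ⟨h1, h2, h3⟩ := hw w hw'
      have hGw : G < w := hw'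
      have hw0 : 0 < w := hG0.trans hGw
      have hv : ∫ x : ℝ, ‖x ^ 2 * ((w ^ 2 - G ^ 2) ^ α * Real.exp (-(w * |x|) - θ * x))‖
          = (w ^ 2 - G ^ 2) ^ α * (2 / (w + θ) ^ 3 + 2 / (w - θ) ^ 3) := by
        rw [← (integral_sq_mul_two_sided h1 h2).2, ← integral_const_mul]
        refine integral_congr_ae (Eventually.of_forall fun x => ?_)
        simp only
        rw [e, Real.norm_of_nonneg (by positivity)]
      have hcw : c * w ≤ w - |θ| := by
        have : |θ| ≤ |θ| / G * w := by
          rw [div_mul_eq_mul_div, le_div_iff₀ hG0]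
          exact mul_le_mul_of_nonneg_left hGw.le (abs_nonneg _)
        rw [hc]
        linarith
      have hcw0 : 0 < c * w := by positivity
      have hb1 : 2 / (w + θ) ^ 3 ≤ 2 / (c * w) ^ 3 := by
        gcongr
        linarith [neg_abs_le θ]
      have hb2 : 2 / (w - θ) ^ 3 ≤ 2 / (c * w) ^ 3 := by
        gcongr
        linarith [le_abs_self θ]
      have hb3 : (w ^ 2 - G ^ 2) ^ α ≤ w ^ (2 * α) := by
        rw [Real.rpow_mul hw0.le, Real.rpow_two]
        gcongr
        linarith [sq_nonneg G]
      rw [hv, Real.norm_of_nonneg (by positivity)]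
      calc (w ^ 2 - G ^ 2) ^ α * (2 / (w + θ) ^ 3 + 2 / (w - θ) ^ 3)
          ≤ w ^ (2 * α) * (2 / (c * w) ^ 3 + 2 / (c * w) ^ 3) := by gcongr
        _ = 4 / c ^ 3 * w ^ (2 * α - 3) := by
          have e3 : w ^ (2 * α - 3) = w ^ (2 * α) / w ^ 3 := by
            rw [Real.rpow_sub hw0]
            norm_cast
          rw [e3]
          field_simp
          ring

theorem integrable_sq_mul_expMixture (hα0 : 0 < α) (hα1 : α < 1) (hG : |θ| < G) :
    Integrable fun x => x ^ 2 * expMixture α G θ x := by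
  refine (integrable_sq_mul_mixture_kernel hα0 hα1 hG).integral_prod_right.congr ?_
  refine Eventually.of_forall fun x => ?_
  simp only [expMixture]
  rw [integral_const_mul]

theorem integrable_mul_expMixture (hα0 : 0 < α) (hα1 : α < 1) (hG : |θ| < G) {g : ℝ → ℂ}
    (hg : Measurable g) {C : ℝ} (hC : ∀ x, ‖g x‖ ≤ C * x ^ 2) :
    Integrable fun x => g x * (expMixture α G θ x : ℂ) := by
  have h := (integrable_sq_mul_expMixture hα0 hα1 hG).ofReal (𝕜 := ℂ)
  have h2 : Integrable fun x => (g x / (x : ℂ) ^ 2) * ((x ^ 2 * expMixture α G θ x : ℝ) : ℂ) := by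
    refine h.bdd_mul (c := |C|) (Measurable.aestronglyMeasurable (by fun_prop)) ?_
    refine Eventually.of_forall fun x => ?_
    rw [norm_div, norm_pow, Complex.norm_real, Real.norm_eq_abs, sq_abs]
    refine div_le_of_le_mul₀ (by positivity) (by positivity) ((hC x).trans ?_)
    gcongr
    exact le_abs_self C
  refine h2.congr (Eventually.of_forall fun x => ?_)
  -- At `x = 0` the quotient `g x / x²` is `0` by convention, and the bound forces `g 0 = 0`.
  rcases eq_or_ne x 0 with rfl | hx
  · have : g 0 = 0 := by simpa using hC 0
    simp [this]
  · have hx' : (x : ℂ) ≠ 0 := by exact_mod_cast hx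
    simp only
    push_cast
    field_simp

theorem norm_compensated_le (u x : ℝ) :
    ‖Complex.exp (Complex.I * u * x) - 1 - Complex.I * u * x‖ ≤ 3 * u ^ 2 * x ^ 2 := by
  have hn : ‖Complex.I * u * x‖ = |u * x| := by
    rw [mul_assoc, norm_mul, Complex.norm_I, one_mul, ← Complex.ofReal_mul, Complex.norm_real,
      Real.norm_eq_abs]
  rcases le_total (|u * x|) 1 with h | h
  · have := Complex.norm_exp_sub_one_sub_id_le (x := Complex.I * u * x) (by rwa [hn])
    rw [hn, sq_abs] at this
    nlinarith [sq_nonneg (u * x)]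
  -- For `|ux| ≥ 1` the crude bound `2 + |ux| ≤ 3 (ux)²` is the source of the constant `3`.
  · have h1 : ‖Complex.exp (Complex.I * u * x)‖ = 1 := by
      rw [mul_assoc, ← Complex.ofReal_mul]
      exact Complex.norm_exp_I_mul_ofReal _
    have h2 : ‖Complex.exp (Complex.I * u * x) - 1 - Complex.I * u * x‖ ≤ 1 + 1 + |u * x| := by
      refine (norm_sub_le _ _).trans ?_
      rw [hn]
      gcongr
      refine (norm_sub_le _ _).trans ?_
      rw [h1, norm_one]
    have h3 : (u * x) ^ 2 = |u * x| ^ 2 := (sq_abs _).symm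
    nlinarith

/-- Substitution `l = w² - G²`. -/
theorem integral_comp_sq_sub_sq (hG : 0 < G) (g : ℝ → ℂ) :
    ∫ w in Set.Ioi G, ((2 * w : ℝ) : ℂ) * g (w ^ 2 - G ^ 2) = ∫ l in Set.Ioi 0, g l := by
  have himg : (fun w : ℝ => w ^ 2 - G ^ 2) '' Set.Ioi G = Set.Ioi 0 := by
    ext l
    constructor
    · rintro ⟨w, hw, rfl⟩
      have : G < w := hw
      simp only [Set.mem_Ioi]
      nlinarith
    · intro hl
      have hl0 : 0 < l := hl
      refine ⟨Real.sqrt (l + G ^ 2), ?_, ?_⟩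
      · exact Real.lt_sqrt_of_sq_lt (by linarith)
      · simp only
        rw [Real.sq_sqrt (by positivity)]
        ring
  have hinj : Set.InjOn (fun w : ℝ => w ^ 2 - G ^ 2) (Set.Ioi G) := by
    intro x hx y hy hxy
    have hx' : G < x := hx
    have hy' : G < y := hy
    have : (x - y) * (x + y) = 0 := by linarith
    rcases mul_eq_zero.1 this with h | h
    · linarith
    · linarith
  rw [← himg, integral_image_eq_integral_abs_deriv_smul (f' := fun w => 2 * w) measurableSet_Ioi
    (fun w _ => ?_) hinj]
  · refine setIntegral_congr_fun measurableSet_Ioi fun w hw => ?_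
    have : G < w := hw
    rw [abs_of_pos (by linarith), Complex.real_smul]
  · have := ((hasDerivAt_pow 2 w).sub_const (G ^ 2)).hasDerivWithinAt (s := Set.Ioi G)
    simpa using this

/-- Integrate in `x` first. Because `(w + θ - iu)(w - θ + iu) = (w² - G²) + z` with `z = (G + θ -
iu)(G - θ + iu)`, the partial fractions combine to `2w` times a function of `l = w² - G²`, and the
Stieltjes integral finishes. -/
theorem integral_compensated_mul_expMixture (hα0 : 0 < α) (hα1 : α < 1) (hG : |θ| < G) :
    ∃ γ : ℝ, ∀ u : ℝ, ∫ x : ℝ, (Complex.exp (Complex.I * u * x) - 1 - Complex.I * u * x)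
        * (expMixture α G θ x : ℂ)
      = (Real.Gamma α * Real.Gamma (1 - α) : ℝ) * (((((G + θ) * (G - θ)) ^ α : ℝ) : ℂ)
        - (((G + θ : ℝ) - Complex.I * u) * ((G - θ : ℝ) + Complex.I * u)) ^ (α : ℂ))
        + Complex.I * u * γ := by
  have hG0 : 0 < G := (abs_nonneg θ).trans_lt hG
  have hθ := abs_lt.1 hG
  have ha : 0 < G + θ := by linarith
  have hb : 0 < G - θ := by linarith
  set z₀ : ℝ := (G + θ) * (G - θ) with hz₀
  have hz₀pos : 0 < z₀ := mul_pos ha hb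
  -- The linear compensators contribute `iu (1/(w - θ)² - 1/(w + θ)²) = 2w · 2iuθ / (l + z₀)²`.
  refine ⟨2 * θ * ∫ l in Set.Ioi (0 : ℝ), l ^ α * (1 / (l + z₀) ^ 2), fun u => ?_⟩
  set z : ℂ := ((G + θ : ℝ) - Complex.I * u) * ((G - θ : ℝ) + Complex.I * u) with hz
  have hzre : 0 < z.re := stableBase_re_pos (by simp; linarith) (by simpa using hb)
  have hz₀re : 0 < (z₀ : ℂ).re := by simpa using hz₀pos
  set g : ℝ → ℂ := fun l => ((l ^ α : ℝ) : ℂ) * (1 / (l + z) - 1 / (l + (z₀ : ℂ)))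
    + 2 * Complex.I * u * θ * (((l ^ α : ℝ) : ℂ) * (1 / (l + (z₀ : ℂ)) ^ 2)) with hg
  have hK : Integrable (fun p : ℝ × ℝ =>
      (Complex.exp (Complex.I * u * p.2) - 1 - Complex.I * u * p.2) *
        (((p.1 ^ 2 - G ^ 2) ^ α * Real.exp (-(p.1 * |p.2|) - θ * p.2) : ℝ) : ℂ))
      ((volume.restrict (Set.Ioi G)).prod volume) := by
    refine Integrable.mono' ((integrable_sq_mul_mixture_kernel hα0 hα1 hG).norm.const_mul
      (3 * u ^ 2)) (Measurable.aestronglyMeasurable ?_) (Eventually.of_forall fun p => ?_)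
    · exact (by fun_prop : Measurable fun p : ℝ × ℝ =>
        Complex.exp (Complex.I * u * p.2) - 1 - Complex.I * u * p.2).mul
        (Complex.measurable_ofReal.comp measurable_mixture_kernel)
    · rw [norm_mul, Complex.norm_real, norm_mul (p.2 ^ 2), ← mul_assoc,
        Real.norm_of_nonneg (sq_nonneg _)]
      exact mul_le_mul_of_nonneg_right (norm_compensated_le u p.2) (norm_nonneg _)
  have hinner : ∀ w ∈ Set.Ioi G,
      ∫ x : ℝ, (Complex.exp (Complex.I * u * x) - 1 - Complex.I * u * x) *
        (((w ^ 2 - G ^ 2) ^ α * Real.exp (-(w * |x|) - θ * x) : ℝ) : ℂ)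
      = ((2 * w : ℝ) : ℂ) * g (w ^ 2 - G ^ 2) := by
    intro w hw
    have hGw : G < w := hw
    have h1 : 0 < w + θ := by linarith
    have h2 : 0 < w - θ := by linarith
    have e : ∀ x : ℝ, (Complex.exp (Complex.I * u * x) - 1 - Complex.I * u * x) *
        (((w ^ 2 - G ^ 2) ^ α * Real.exp (-(w * |x|) - θ * x) : ℝ) : ℂ)
        = (((w ^ 2 - G ^ 2) ^ α : ℝ) : ℂ) *
          ((Complex.exp (Complex.I * u * x) - 1 - Complex.I * u * x) *
            ((Real.exp (-(w * |x|) - θ * x) : ℝ) : ℂ)) := by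
      intro x
      rw [Complex.ofReal_mul]
      ring
    simp_rw [e]
    rw [integral_const_mul, integral_compensated_mul_two_sided h1 h2]
    have n1 : ((w + θ : ℝ) : ℂ) ≠ 0 := by exact_mod_cast h1.ne'
    have n2 : ((w - θ : ℝ) : ℂ) ≠ 0 := by exact_mod_cast h2.ne'
    have n3 : ((w + θ : ℝ) : ℂ) - Complex.I * u ≠ 0 := by
      intro h
      have := congrArg Complex.re h
      simp at this
      linarith
    have n4 : ((w - θ : ℝ) : ℂ) + Complex.I * u ≠ 0 := by
      intro h
      have := congrArg Complex.re h
      simp at this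
      linarith
    have d1 : ((w ^ 2 - G ^ 2 : ℝ) : ℂ) + z
        = (((w + θ : ℝ) : ℂ) - Complex.I * u) * (((w - θ : ℝ) : ℂ) + Complex.I * u) := by
      rw [hz]
      push_cast
      ring
    have d2 : ((w ^ 2 - G ^ 2 : ℝ) : ℂ) + z₀ = ((w + θ : ℝ) : ℂ) * ((w - θ : ℝ) : ℂ) := by
      rw [hz₀]
      push_cast
      ring
    rw [hg]
    simp only
    rw [d1, d2]
    have s1 : 1 / (((w + θ : ℝ) : ℂ) - Complex.I * u) + 1 / (((w - θ : ℝ) : ℂ) + Complex.I * u)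
        = 2 * w * (1 / ((((w + θ : ℝ) : ℂ) - Complex.I * u)
          * (((w - θ : ℝ) : ℂ) + Complex.I * u))) := by
      field_simp
      push_cast
      ring
    have s2 : 1 / ((w + θ : ℝ) : ℂ) + 1 / ((w - θ : ℝ) : ℂ)
        = 2 * w * (1 / (((w + θ : ℝ) : ℂ) * ((w - θ : ℝ) : ℂ))) := by
      field_simp
      push_cast
      ring
    have s3 : 1 / ((w - θ : ℝ) : ℂ) ^ 2 - 1 / ((w + θ : ℝ) : ℂ) ^ 2
        = 4 * w * θ * (1 / (((w + θ : ℝ) : ℂ) * ((w - θ : ℝ) : ℂ)) ^ 2) := by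
      field_simp
      push_cast
      ring
    rw [Complex.ofReal_mul, Complex.ofReal_ofNat]
    linear_combination (((w ^ 2 - G ^ 2) ^ α : ℝ) : ℂ) * s1
      - (((w ^ 2 - G ^ 2) ^ α : ℝ) : ℂ) * s2
      + (((w ^ 2 - G ^ 2) ^ α : ℝ) : ℂ) * Complex.I * u * s3
  have hρ : ∀ x : ℝ, (Complex.exp (Complex.I * u * x) - 1 - Complex.I * u * x)
        * (expMixture α G θ x : ℂ)
      = ∫ w in Set.Ioi G, (Complex.exp (Complex.I * u * x) - 1 - Complex.I * u * x) *
        (((w ^ 2 - G ^ 2) ^ α * Real.exp (-(w * |x|) - θ * x) : ℝ) : ℂ) := by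
    intro x
    rw [integral_const_mul, integral_complex_ofReal, expMixture]
  simp_rw [hρ]
  rw [← integral_integral_swap (f := fun w x : ℝ =>
      (Complex.exp (Complex.I * u * x) - 1 - Complex.I * u * x) *
        (((w ^ 2 - G ^ 2) ^ α * Real.exp (-(w * |x|) - θ * x) : ℝ) : ℂ)) hK,
    setIntegral_congr_fun measurableSet_Ioi hinner, integral_comp_sq_sub_sq hG0]
  obtain ⟨i1, v1⟩ := integrableOn_rpow_mul_inv_sub_inv hα0 hα1 hz₀re hzre
  have i2 := (integrableOn_rpow_div_sq hα0 hα1 hz₀pos).const_mul (2 * Complex.I * u * θ)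
  have v2 : ∫ l in Set.Ioi (0 : ℝ), ((l ^ α : ℝ) : ℂ) * (1 / (l + (z₀ : ℂ)) ^ 2)
      = ((∫ l in Set.Ioi (0 : ℝ), l ^ α * (1 / (l + z₀) ^ 2) : ℝ) : ℂ) := by
    rw [← integral_complex_ofReal]
    congr 1
    ext l
    push_cast
    rfl
  rw [hg, integral_add i1 i2, v1, integral_const_mul, v2, Complex.ofReal_cpow hz₀pos.le]
  push_cast
  ring

/-- The Lévy-Khintchine formula for the exponential of a tempered stable exponent. -/
theorem isJumpDensity_of_charFun_eq_exp (hα0 : 0 < α) (hα1 : α < 1) (hG : |θ| < G) {B D c : ℝ}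
    (hD : 0 ≤ D) (hB : B = D * (Real.Gamma α * Real.Gamma (1 - α))) {m : Measure ℝ}
    (hm : ∀ u : ℝ, charFun m u = Complex.exp (stableExponent α (G + θ) (G - θ) B c u))
    {n : ℝ → ℝ} (hn0 : n 0 = 0) (hn : ∀ x, x ≠ 0 → n x = D * expMixture α G θ x) :
    IsJumpDensity m n := by
  have hae : ∀ᵐ x : ℝ, n x = D * expMixture α G θ x := by
    filter_upwards [compl_mem_ae_iff.2 (measure_singleton (0 : ℝ))] with x hx
    exact hn x hx
  have hnonneg : ∀ x, 0 ≤ expMixture α G θ x := by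
    intro x
    refine setIntegral_nonneg measurableSet_Ioi fun w hw => ?_
    have h : G < w := hw
    have hG0 : 0 < G := (abs_nonneg θ).trans_lt hG
    have : 0 ≤ w ^ 2 - G ^ 2 := by nlinarith
    positivity
  refine ⟨fun x => ?_, ?_, ?_⟩
  · rcases eq_or_ne x 0 with rfl | hx
    · exact hn0.ge
    · rw [hn x hx]
      exact mul_nonneg hD (hnonneg x)
  · have h := (integrable_mul_expMixture hα0 hα1 hG (g := fun x => ((min 1 (x ^ 2) : ℝ) : ℂ))
      (by fun_prop) (C := 1) (fun x => by
        rw [Complex.norm_real, Real.norm_of_nonneg (by positivity), one_mul]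
        exact min_le_right _ _)).re.const_mul D
    refine h.congr ?_
    filter_upwards [hae] with x hx
    rw [hx, ← Complex.ofReal_mul]
    simp only [RCLike.re_to_complex, Complex.ofReal_re]
    ring
  · obtain ⟨γ, hγ⟩ := integral_compensated_mul_expMixture hα0 hα1 hG
    -- Adding `iu g(x)` changes the full compensator `iux` into the one truncated at `|x| ≤ 1`; this
    -- only shifts the drift.
    set g : ℝ → ℂ := fun x => if |x| ≤ 1 then 0 else (x : ℂ) with hg
    have hgm : Measurable g :=
      Measurable.ite (measurableSet_le measurable_norm measurable_const) measurable_const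
        Complex.measurable_ofReal
    have hgi := integrable_mul_expMixture hα0 hα1 hG hgm (C := 1) (fun x => by
      rw [hg]
      simp only
      split_ifs with h
      · simpa using sq_nonneg x
      · rw [Complex.norm_real, Real.norm_eq_abs, one_mul, ← sq_abs]
        nlinarith)
    have hgreal : ∃ δ : ℝ, ∫ x, g x * (expMixture α G θ x : ℂ) = δ := by
      refine ⟨∫ x, (if |x| ≤ 1 then 0 else x) * expMixture α G θ x, ?_⟩
      rw [← integral_complex_ofReal]
      congr 1
      ext x
      rw [hg]
      simp only
      split_ifs <;> simp
    obtain ⟨δ, hδ⟩ := hgreal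
    refine ⟨0, -c - D * γ - D * δ, le_rfl, fun u => ?_⟩
    have hi := integrable_mul_expMixture hα0 hα1 hG
      (g := fun x => Complex.exp (Complex.I * u * x) - 1 - Complex.I * u * x)
      (by fun_prop) (norm_compensated_le u)
    have hint : ∫ x : ℝ, (Complex.exp (Complex.I * u * x) - 1
          - (if |x| ≤ 1 then Complex.I * u * x else 0)) * (n x : ℂ)
        = D * (∫ x : ℝ, (Complex.exp (Complex.I * u * x) - 1 - Complex.I * u * x)
          * (expMixture α G θ x : ℂ)) + D * (Complex.I * u * δ) := by
      rw [← hδ, ← integral_const_mul, ← integral_const_mul, ← integral_const_mul,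
        ← integral_add (hi.const_mul _) ((hgi.const_mul _).const_mul _)]
      refine integral_congr_ae ?_
      filter_upwards [hae] with x hx
      rw [hx, hg]
      simp only
      push_cast
      split_ifs <;> ring
    rw [hm, hint, hγ, stableExponent, hB]
    congr 1
    push_cast
    ring

end

/-! ### The jump density as a Laplace transform -/

section

variable {α : ℝ}

theorem integral_comp_add_right_Ioi_zero (g : ℝ → ℝ) (c : ℝ) :
    ∫ x in Set.Ioi 0, g (x + c) = ∫ x in Set.Ioi c, g x := by
  have h := (measurePreserving_add_right (volume : Measure ℝ) c).setIntegral_preimage_emb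
    (measurableEmbedding_addRight c) g (Set.Ioi c)
  simpa using h

/-- The Bessel function of order `α + 1 / 2` as a mixture of exponentials. -/
theorem besselK_eq_integral {r G : ℝ} (hr : 0 < r) (hG : 0 < G) :
    besselK (α + 1 / 2) (r * G) = 1 / Real.Gamma (α + 1) * Real.sqrt (Real.pi / (2 * (r * G)))
      * (r * r ^ α / (2 * G) ^ α)
      * ∫ w in Set.Ioi G, (w ^ 2 - G ^ 2) ^ α * Real.exp (-(w * r)) := by
  -- Substitute `z = r y` and then `w = y + G`, so that `y (y + 2G) = w² - G²`.
  have e1 : ∫ z in Set.Ioi (0 : ℝ), Real.exp (-z) * z ^ α * (1 + z / (2 * (r * G))) ^ α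
      = r * ∫ y in Set.Ioi (0 : ℝ), Real.exp (-(r * y)) * (r * y) ^ α
        * (1 + r * y / (2 * (r * G))) ^ α := by
    have := integral_comp_mul_left_Ioi
      (fun z => Real.exp (-z) * z ^ α * (1 + z / (2 * (r * G))) ^ α) 0 hr
    rw [this, mul_zero, smul_eq_mul, mul_inv_cancel_left₀ hr.ne']
  have e2 : ∀ y ∈ Set.Ioi (0 : ℝ), Real.exp (-(r * y)) * (r * y) ^ α
        * (1 + r * y / (2 * (r * G))) ^ α
      = Real.exp (r * G) * (r ^ α / (2 * G) ^ α)
        * (((y + G) ^ 2 - G ^ 2) ^ α * Real.exp (-((y + G) * r))) := by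
    intro y hy
    have hy0 : 0 < y := hy
    have h1 : 1 + r * y / (2 * (r * G)) = (y + 2 * G) / (2 * G) := by
      field_simp
      ring
    have h2 : (y + G) ^ 2 - G ^ 2 = y * (y + 2 * G) := by ring
    have h3 : Real.exp (-(r * y)) = Real.exp (r * G) * Real.exp (-((y + G) * r)) := by
      rw [← Real.exp_add]
      ring_nf
    rw [h1, h2, h3, Real.div_rpow (by positivity) (by positivity),
      Real.mul_rpow hr.le hy0.le, Real.mul_rpow hy0.le (by positivity)]
    ring
  rw [besselK, show α + 1 / 2 + 1 / 2 = α + 1 by ring, show α + 1 / 2 - 1 / 2 = α by ring, e1,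
    setIntegral_congr_fun measurableSet_Ioi e2, integral_const_mul,
    integral_comp_add_right_Ioi_zero (fun w => (w ^ 2 - G ^ 2) ^ α * Real.exp (-(w * r))) G,
    Real.exp_neg]
  field_simp

theorem expMixture_neg (G θ x : ℝ) : expMixture α G θ (-x) = expMixture α G (-θ) x := by
  simp only [expMixture, abs_neg, mul_neg, neg_mul]

/-- The density in the Laplace representation of the mixture on the half-line. -/
noncomputable def stableKernel (α a b q : ℝ) : ℝ :=
  (max (q - a) 0 * (q + b)) ^ α

theorem stableKernel_eq_zero (hα0 : 0 < α) {a b q : ℝ} (h : q ≤ a) : stableKernel α a b q = 0 := by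
  rw [stableKernel, max_eq_right (by linarith), zero_mul, Real.zero_rpow hα0.ne']

theorem stableKernel_of_lt {a b q : ℝ} (h : a < q) :
    stableKernel α a b q = ((q - a) * (q + b)) ^ α := by
  rw [stableKernel, max_eq_left (by linarith)]

theorem stableKernel_nonneg {a b q : ℝ} (hb : 0 < b) (hq : 0 < q) : 0 ≤ stableKernel α a b q :=
  Real.rpow_nonneg (mul_nonneg (le_max_right _ _) (by linarith)) _

/-- For `q > a`, `(q - a)(q + b) / (a + b)` is the reciprocal of `1/(q - a) - 1/(q + b)`, hence
grows when `a` or `b` decreases. Multiply its power `α` by `D (a + b)^α`. For `q ≤ a` the left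
kernel vanishes. -/
theorem stableKernel_weighted {a b a' b' D D' q : ℝ} (hα0 : 0 < α) (ha' : 0 < a') (hb' : 0 < b')
    (ha : a' ≤ a) (hb : b' ≤ b) (hD : 0 < D) (h : D * (a + b) ^ α ≤ D' * (a' + b') ^ α)
    (hq : 0 < q) : D * stableKernel α a b q ≤ D' * stableKernel α a' b' q ∧
      (D < D' → a < q → D * stableKernel α a b q < D' * stableKernel α a' b' q) := by
  have hD' : 0 < D' := by
    have : 0 < D' * (a' + b') ^ α := lt_of_lt_of_le (mul_pos hD (Real.rpow_pos_of_pos (by linarith) _)) h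
    exact (pos_iff_pos_of_mul_pos this).2 (Real.rpow_pos_of_pos (by linarith) _)
  rcases le_or_gt q a with hqa | hqa
  · refine ⟨?_, fun _ h => absurd h hqa.not_gt⟩
    rw [stableKernel_eq_zero hα0 hqa, mul_zero]
    exact mul_nonneg hD'.le (stableKernel_nonneg hb' hq)
  have hqa' : a' < q := ha.trans_lt hqa
  rw [stableKernel_of_lt hqa, stableKernel_of_lt hqa']
  have hP : 0 < q - a := by linarith
  have hP' : 0 < q - a' := by linarith
  have hR' : 0 < q + b' := by linarith
  have hR : 0 < q + b := by linarith
  have hs : 0 < (a' + b') ^ α := by positivity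
  have key : (q - a') * (q + b') * (a + b) - (q - a) * (q + b) * (a' + b')
      = (q + b) * (q + b') * (a - a') + (q - a) * (q - a') * (b - b') := by ring
  have k1 : 0 ≤ (q + b) * (q + b') * (a - a') := mul_nonneg (by positivity) (by linarith)
  have k2 : 0 ≤ (q - a) * (q - a') * (b - b') := mul_nonneg (by positivity) (by linarith)
  have hl : D * ((q - a) * (q + b)) ^ α * (a' + b') ^ α
      = D * ((q - a) * (q + b) * (a' + b')) ^ α := by
    rw [Real.mul_rpow (by positivity) (by positivity : 0 ≤ a' + b')]
    ring
  have hr : D * ((q - a') * (q + b') * (a + b)) ^ α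
      ≤ D' * ((q - a') * (q + b')) ^ α * (a' + b') ^ α := by
    rw [Real.mul_rpow (by positivity) (by linarith : 0 ≤ a + b)]
    have : 0 < ((q - a') * (q + b')) ^ α := by positivity
    nlinarith
  have hX : 0 ≤ (q - a) * (q + b) * (a' + b') := by positivity
  constructor
  · refine le_of_mul_le_mul_right ?_ hs
    rw [hl]
    exact (mul_le_mul_of_nonneg_left (Real.rpow_le_rpow hX (by linarith) hα0.le) hD.le).trans hr
  · intro hlt _
    by_cases hab : a = a' ∧ b = b'
    · rw [hab.1, hab.2]
      gcongr
    · refine lt_of_mul_lt_mul_right ?_ hs.le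
      rw [hl]
      refine lt_of_lt_of_le ?_ hr
      have : 0 < (q + b) * (q + b') * (a - a') + (q - a) * (q - a') * (b - b') := by
        rcases ha.lt_or_eq with h1 | h1
        · have : 0 < (q + b) * (q + b') * (a - a') := mul_pos (by positivity) (by linarith)
          linarith
        · rcases hb.lt_or_eq with h2 | h2
          · have : 0 < (q - a) * (q - a') * (b - b') := mul_pos (by positivity) (by linarith)
            linarith
          · exact absurd ⟨h1.symm, h2.symm⟩ hab
      exact mul_lt_mul_of_pos_left (Real.rpow_lt_rpow hX (by linarith) hα0) hD

theorem integrableOn_rpow_mul_exp {p r : ℝ} (hp : 0 ≤ p) (hr : 0 < r) :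
    IntegrableOn (fun q : ℝ => q ^ p * Real.exp (-(q * r))) (Set.Ioi 0) := by
  have h := Real.integral_rpow_mul_exp_neg_mul_Ioi (a := p + 1) (by positivity) hr
  refine Integrable.of_integral_ne_zero ?_
  simp_rw [add_sub_cancel_right, mul_comm r] at h
  rw [h]
  positivity

/-- The Laplace representation of the mixture on the positive half-line. -/
theorem expMixture_eq_laplace (hα0 : 0 < α) {G θ x : ℝ} (hG : |θ| < G) (hx : 0 < x) :
    IntegrableOn (fun q => stableKernel α (G + θ) (G - θ) q * Real.exp (-(q * x))) (Set.Ioi 0) ∧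
    expMixture α G θ x
      = ∫ q in Set.Ioi 0, stableKernel α (G + θ) (G - θ) q * Real.exp (-(q * x)) := by
  have hG0 : 0 < G := (abs_nonneg θ).trans_lt hG
  have hθ := abs_lt.1 hG
  constructor
  · have hm : Measurable (fun q => stableKernel α (G + θ) (G - θ) q * Real.exp (-(q * x))) := by
      unfold stableKernel
      fun_prop
    have hb : IntegrableOn (fun q : ℝ => (q + (G - θ)) ^ (2 * α) * Real.exp (-(q * x)))
        (Set.Ioi 0) := by
      have h1 : IntegrableOn (fun q : ℝ => q ^ (2 * α) * Real.exp (-(q * x)))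
          (Set.Ioi (G - θ)) :=
        (integrableOn_rpow_mul_exp (by positivity) hx).mono_set (Set.Ioi_subset_Ioi (by linarith))
      have h2 := ((measurePreserving_add_right (volume : Measure ℝ) (G - θ)).integrableOn_comp_preimage
        (measurableEmbedding_addRight (G - θ))).2 h1
      have h3 : IntegrableOn (fun q : ℝ => (q + (G - θ)) ^ (2 * α)
          * Real.exp (-((q + (G - θ)) * x))) (Set.Ioi 0) := by
        simpa [Function.comp_def] using h2
      refine (h3.const_mul (Real.exp ((G - θ) * x))).congr (Eventually.of_forall fun q => ?_)
      simp only
      rw [mul_left_comm, ← Real.exp_add]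
      ring_nf
    refine Integrable.mono' hb hm.aestronglyMeasurable ?_
    filter_upwards [self_mem_ae_restrict measurableSet_Ioi] with q hq
    have hq0 : 0 < q := hq
    have hb0 : 0 < G - θ := by linarith
    rw [Real.norm_of_nonneg (mul_nonneg (stableKernel_nonneg hb0 hq0) (by positivity))]
    refine mul_le_mul_of_nonneg_right ?_ (by positivity)
    rw [stableKernel, Real.rpow_mul (by positivity), Real.rpow_two, sq]
    have : max (q - (G + θ)) 0 ≤ q + (G - θ) := max_le (by linarith) (by positivity)
    gcongr
  · have h1 : ∫ q in Set.Ioi 0, stableKernel α (G + θ) (G - θ) q * Real.exp (-(q * x))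
        = ∫ q in Set.Ioi (G + θ), stableKernel α (G + θ) (G - θ) q * Real.exp (-(q * x)) := by
      refine (setIntegral_eq_of_subset_of_forall_sdiff_eq_zero measurableSet_Ioi
        (Set.Ioi_subset_Ioi (by linarith)) fun q hq => ?_)
      rw [stableKernel_eq_zero hα0 (not_lt.1 hq.2), zero_mul]
    -- The substitution is `q = w + θ`, for which `(q - a)(q + b) = w² - G²`; both integrals are
    -- shifted to start at `0`.
    rw [h1, ← integral_comp_add_right_Ioi_zero, expMixture, ← integral_comp_add_right_Ioi_zero]
    refine setIntegral_congr_fun measurableSet_Ioi fun y hy => ?_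
    have hy0 : 0 < y := hy
    rw [stableKernel_of_lt (by linarith), abs_of_pos hx]
    ring_nf

theorem laplace_pos_antitone {h : ℝ → ℝ} {a : ℝ} (hnn : ∀ q, 0 < q → 0 ≤ h q) (ha : 0 < a)
    (hpos : ∀ q, a < q → 0 < h q)
    (hint : ∀ x, 0 < x → IntegrableOn (fun q => h q * Real.exp (-(q * x))) (Set.Ioi 0)) :
    (∀ x, 0 < x → 0 < ∫ q in Set.Ioi 0, h q * Real.exp (-(q * x))) ∧
      AntitoneOn (fun x => ∫ q in Set.Ioi 0, h q * Real.exp (-(q * x))) (Set.Ioi 0) := by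
  constructor
  · intro x hx
    rw [setIntegral_pos_iff_support_of_nonneg_ae _ (hint x hx)]
    · refine lt_of_lt_of_le ?_ (measure_mono (s := Set.Ioi a) fun q hq => ⟨?_, ?_⟩)
      · simp
      · exact (mul_pos (hpos q hq) (Real.exp_pos _)).ne'
      · exact ha.trans hq
    · filter_upwards [self_mem_ae_restrict measurableSet_Ioi] with q hq
      exact mul_nonneg (hnn q hq) (Real.exp_pos _).le
  · intro x hx y hy hxy
    refine setIntegral_mono_on (hint y hy) (hint x hx) measurableSet_Ioi fun q hq => ?_
    have : 0 < q := hq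
    have := hnn q hq
    gcongr

end

/-! ### The jump density of the process and its growth in time. -/

section

variable {α : ℝ} {σ k η : ℝ≥0 → ℝ} {t : ℝ≥0}

theorem abs_half_add_lt_atsRoot (hα1 : α < 1) (hpar : IsATSParameters α σ k η) (ht : 0 < t) :
    |1 / 2 + η t| < atsRoot α σ k η t := by
  rw [abs_of_pos (by linarith [hpar.η_nonneg t ht])]
  exact half_add_lt_atsRoot hα1 hpar ht

/-- The weight of the mixture of exponentials in the jump density. -/
noncomputable def atsWeight (α : ℝ) (σ k : ℝ≥0 → ℝ) (t : ℝ≥0) : ℝ :=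
  atsScale α σ k t / (Real.Gamma α * Real.Gamma (1 - α))

theorem Gamma_mul_Gamma_pos (hα0 : 0 < α) (hα1 : α < 1) :
    0 < Real.Gamma α * Real.Gamma (1 - α) :=
  mul_pos (Real.Gamma_pos_of_pos hα0) (Real.Gamma_pos_of_pos (sub_pos.2 hα1))

/-- At `x = 0` the density divides by `0 ^ (1/2 + α) = 0`, which yields `0`. -/
theorem atsJumpDensity_at_zero (hα0 : 0 < α) (t : ℝ≥0) : atsJumpDensity α σ k η t 0 = 0 := by
  simp [atsJumpDensity, Real.zero_rpow (by positivity : (2 : ℝ)⁻¹ + α ≠ 0)]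

theorem atsJumpDensity_zero (x : ℝ) : atsJumpDensity α σ k η 0 x = 0 := by
  simp [atsJumpDensity]

/-- The powers of `|x|` and of `G` in `besselK_eq_integral` cancel those of the density, and `Γ(α +
1) = α Γ(α)` supplies the `1 / α` of `atsScale`. -/
theorem atsJumpDensity_eq_expMixture (hα0 : 0 < α) (hα1 : α < 1)
    (hpar : IsATSParameters α σ k η) (ht : 0 < t) {x : ℝ} (hx : x ≠ 0) :
    atsJumpDensity α σ k η t x
      = atsWeight α σ k t * expMixture α (atsRoot α σ k η t) (1 / 2 + η t) x := by
  have hk := hpar.k_pos t ht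
  have hσ := hpar.σ_pos t
  have h1 := sub_pos.2 hα1
  have hG := atsRoot_pos hα1 hpar ht
  have hr : 0 < |x| := abs_pos.2 hx
  have hGsq : (1 / 2 + η t) ^ 2 + 2 * (1 - α) / (k t * (σ t) ^ 2) = atsRoot α σ k η t ^ 2 := by
    rw [atsRoot_sq hα1 hpar ht, mul_comm (k t)]
  set G := atsRoot α σ k η t
  set r := |x| with hr'
  have hmix : expMixture α G (1 / 2 + η t) x = Real.exp (-(1 / 2 + η t) * x)
      * ∫ w in Set.Ioi G, (w ^ 2 - G ^ 2) ^ α * Real.exp (-(w * r)) := by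
    rw [← integral_const_mul, expMixture]
    congr 1
    ext w
    rw [mul_left_comm, ← Real.exp_add, hr']
    ring_nf
  rw [atsJumpDensity, atsJumpConst, hGsq, Real.sqrt_sq hG.le, besselK_eq_integral hr hG, hmix,
    atsWeight, atsScale]
  set J := ∫ w in Set.Ioi G, (w ^ 2 - G ^ 2) ^ α * Real.exp (-(w * r))
  have p1 : (G ^ 2) ^ (α / 2 + 1 / 4) = G ^ α * Real.sqrt G := by
    rw [← Real.rpow_natCast, ← Real.rpow_mul hG.le, Real.sqrt_eq_rpow, ← Real.rpow_add hG]
    congr 1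
    push_cast
    ring
  have p2 : r ^ (1 / 2 + α) = Real.sqrt r * r ^ α := by
    rw [Real.rpow_add hr, Real.sqrt_eq_rpow]
  have p3 : ((1 - α) / k t) ^ (1 - α) = (1 - α) / k t * (k t ^ α / (1 - α) ^ α) := by
    rw [Real.rpow_sub (by positivity), Real.rpow_one, Real.div_rpow h1.le hk.le]
    field_simp
  have p4 : σ t ^ (2 * α) = (σ t ^ 2) ^ α := by
    rw [Real.rpow_mul hσ.le, Real.rpow_two]
  have p5 : (σ t ^ 2 * k t / (2 * (1 - α))) ^ α
      = (σ t ^ 2) ^ α * k t ^ α / (2 ^ α * (1 - α) ^ α) := by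
    rw [Real.div_rpow (by positivity) (by positivity), Real.mul_rpow (by positivity) hk.le,
      Real.mul_rpow (by positivity) h1.le]
  have p6 : (2 * G) ^ α = 2 ^ α * G ^ α := Real.mul_rpow (by positivity) hG.le
  have p7 : Real.sqrt (Real.pi / (2 * (r * G)))
      = Real.sqrt Real.pi / (Real.sqrt 2 * (Real.sqrt r * Real.sqrt G)) := by
    rw [Real.sqrt_div Real.pi_pos.le, Real.sqrt_mul (by norm_num), Real.sqrt_mul hr.le]
  have p8 : Real.sqrt (2 * Real.pi) = Real.sqrt 2 * Real.sqrt Real.pi :=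
    Real.sqrt_mul (by norm_num) _
  have p9 : Real.Gamma (α + 1) = α * Real.Gamma α := Real.Gamma_add_one hα0.ne'
  have s2 : Real.sqrt 2 ^ 2 = 2 := Real.sq_sqrt (by norm_num)
  have sr : Real.sqrt r ^ 2 = r := Real.sq_sqrt hr.le
  rw [p1, p2, p3, p4, p5, p6, p7, p8, p9]
  have q1 : 0 < Real.sqrt G := Real.sqrt_pos.2 hG
  have q2 : 0 < Real.sqrt r := Real.sqrt_pos.2 hr
  have q3 : 0 < Real.sqrt Real.pi := Real.sqrt_pos.2 Real.pi_pos
  have q4 : 0 < Real.Gamma α := Real.Gamma_pos_of_pos hα0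
  have q5 : 0 < Real.Gamma (1 - α) := Real.Gamma_pos_of_pos h1
  have q6 : 0 < G ^ α := by positivity
  have q7 : 0 < r ^ α := by positivity
  have q8 : 0 < (1 - α) ^ α := by positivity
  have q9 : (0 : ℝ) < 2 ^ α := by positivity
  field_simp
  rw [s2, sr]

/-- The Laplace representation of the jump density on both half-lines. -/
theorem atsJumpDensity_eq_laplace (hα0 : 0 < α) (hα1 : α < 1)
    (hpar : IsATSParameters α σ k η) (ht : 0 < t) {x : ℝ} (hx : 0 < x) :
    (IntegrableOn (fun q => atsWeight α σ k t * stableKernel α (atsLower α σ k η t)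
        (atsUpper α σ k η t) q * Real.exp (-(q * x))) (Set.Ioi 0) ∧
      atsJumpDensity α σ k η t x = ∫ q in Set.Ioi 0, atsWeight α σ k t *
        stableKernel α (atsLower α σ k η t) (atsUpper α σ k η t) q * Real.exp (-(q * x))) ∧
    (IntegrableOn (fun q => atsWeight α σ k t * stableKernel α (atsUpper α σ k η t)
        (atsLower α σ k η t) q * Real.exp (-(q * x))) (Set.Ioi 0) ∧
      atsJumpDensity α σ k η t (-x) = ∫ q in Set.Ioi 0, atsWeight α σ k t *
        stableKernel α (atsUpper α σ k η t) (atsLower α σ k η t) q * Real.exp (-(q * x))) := by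
  have hG := abs_half_add_lt_atsRoot hα1 hpar ht
  have hG' : |-(1 / 2 + η t)| < atsRoot α σ k η t := by rwa [abs_neg]
  obtain ⟨i1, v1⟩ := expMixture_eq_laplace hα0 hG hx
  obtain ⟨i2, v2⟩ := expMixture_eq_laplace hα0 hG' hx
  -- Reflection in `x` replaces `θ` by `-θ`, which exchanges `a` and `b`.
  rw [sub_neg_eq_add, ← sub_eq_add_neg] at i2 v2
  rw [atsJumpDensity_eq_expMixture hα0 hα1 hpar ht hx.ne',
    atsJumpDensity_eq_expMixture hα0 hα1 hpar ht (neg_ne_zero.2 hx.ne'), expMixture_neg, v1, v2]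
  simp_rw [mul_assoc]
  refine ⟨⟨i1.const_mul _, ?_⟩, ⟨i2.const_mul _, ?_⟩⟩
  · rw [integral_const_mul]
    rfl
  · rw [integral_const_mul]
    rfl

theorem atsWeight_pos (hα0 : 0 < α) (hα1 : α < 1) (hpar : IsATSParameters α σ k η) (ht : 0 < t) :
    0 < atsWeight α σ k t :=
  div_pos (atsScale_pos hα0 hα1 hpar ht) (Gamma_mul_Gamma_pos hα0 hα1)

/-- The difference is the Laplace transform of a difference of kernels, nonnegative by
`stableKernel_weighted` and strictly positive beyond the endpoint of the earlier time. At `s = 0`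
only the kernel of time `t` remains. -/
theorem increment_jumpDensity_pos_antitone (hα0 : 0 < α) (hα1 : α < 1)
    (hpar : IsATSParameters α σ k η) {s : ℝ≥0} (hst : s < t)
    (hlt : atsScale α σ k s < atsScale α σ k t) :
    ((∀ x, 0 < x → 0 < atsJumpDensity α σ k η t x - atsJumpDensity α σ k η s x) ∧
      AntitoneOn (fun x => atsJumpDensity α σ k η t x - atsJumpDensity α σ k η s x)
        (Set.Ioi 0)) ∧
    ((∀ x, 0 < x → 0 < atsJumpDensity α σ k η t (-x) - atsJumpDensity α σ k η s (-x)) ∧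
      AntitoneOn (fun x => atsJumpDensity α σ k η t (-x) - atsJumpDensity α σ k η s (-x))
        (Set.Ioi 0)) := by
  have ht : 0 < t := lt_of_le_of_lt zero_le hst
  have hat := zero_lt_one.trans (one_lt_atsLower hα1 hpar ht)
  have hbt := atsUpper_pos hα1 hpar ht
  have hwt := atsWeight_pos hα0 hα1 hpar ht
  rcases (zero_le (a := s)).eq_or_lt with rfl | hs
  · simp only [atsJumpDensity_zero, sub_zero]
    obtain ⟨p1, m1⟩ := laplace_pos_antitone
      (h := fun q => atsWeight α σ k t * stableKernel α (atsLower α σ k η t)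
        (atsUpper α σ k η t) q)
      (fun q hq => mul_nonneg hwt.le (stableKernel_nonneg hbt hq)) hat
      (fun q hq => by
        rw [stableKernel_of_lt hq]
        have : 0 < q - atsLower α σ k η t := by linarith
        have : 0 < q := by linarith
        positivity)
      (fun x hx => (atsJumpDensity_eq_laplace hα0 hα1 hpar ht hx).1.1)
    obtain ⟨p2, m2⟩ := laplace_pos_antitone
      (h := fun q => atsWeight α σ k t * stableKernel α (atsUpper α σ k η t)
        (atsLower α σ k η t) q)
      (fun q hq => mul_nonneg hwt.le (stableKernel_nonneg hat hq)) hbt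
      (fun q hq => by
        rw [stableKernel_of_lt hq]
        have : 0 < q - atsUpper α σ k η t := by linarith
        have : 0 < q := by linarith
        positivity)
      (fun x hx => (atsJumpDensity_eq_laplace hα0 hα1 hpar ht hx).2.1)
    refine ⟨⟨fun x hx => ?_, m1.congr fun x hx => ?_⟩, ⟨fun x hx => ?_, m2.congr fun x hx => ?_⟩⟩
    · rw [(atsJumpDensity_eq_laplace hα0 hα1 hpar ht hx).1.2]
      exact p1 x hx
    · exact (atsJumpDensity_eq_laplace hα0 hα1 hpar ht hx).1.2.symm
    · rw [(atsJumpDensity_eq_laplace hα0 hα1 hpar ht hx).2.2]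
      exact p2 x hx
    · exact (atsJumpDensity_eq_laplace hα0 hα1 hpar ht hx).2.2.symm
  · have has := zero_lt_one.trans (one_lt_atsLower hα1 hpar hs)
    have hbs := atsUpper_pos hα1 hpar hs
    have hws := atsWeight_pos hα0 hα1 hpar hs
    have hΓ := Gamma_mul_Gamma_pos hα0 hα1
    have hw : atsWeight α σ k s < atsWeight α σ k t := div_lt_div_of_pos_right hlt hΓ
    have hle : atsWeight α σ k s * (atsLower α σ k η s + atsUpper α σ k η s) ^ α
        ≤ atsWeight α σ k t * (atsLower α σ k η t + atsUpper α σ k η t) ^ α := by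
      rw [atsWeight, atsWeight, div_mul_eq_mul_div, div_mul_eq_mul_div]
      exact div_le_div_of_nonneg_right (atsScale_mul_rpow_le hα0 hα1 hpar hs hst.le) hΓ.le
    have hle' := hle
    rw [add_comm, add_comm (atsLower α σ k η t)] at hle'
    have ha := atsLower_antitone hpar hs ht hst.le
    have hb := atsUpper_antitone hpar hs ht hst.le
    have e : ∀ x a b a' b', (fun q => (atsWeight α σ k t * stableKernel α a b q
          - atsWeight α σ k s * stableKernel α a' b' q) * Real.exp (-(q * x)))
        = fun q => atsWeight α σ k t * stableKernel α a b q * Real.exp (-(q * x))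
          - atsWeight α σ k s * stableKernel α a' b' q * Real.exp (-(q * x)) := by
      intro x a b a' b'
      ext q
      ring
    have L := fun x hx => atsJumpDensity_eq_laplace hα0 hα1 hpar ht (x := x) hx
    have L' := fun x hx => atsJumpDensity_eq_laplace hα0 hα1 hpar hs (x := x) hx
    obtain ⟨p1, m1⟩ := laplace_pos_antitone
      (h := fun q => atsWeight α σ k t * stableKernel α (atsLower α σ k η t)
        (atsUpper α σ k η t) q - atsWeight α σ k s * stableKernel α (atsLower α σ k η s)
        (atsUpper α σ k η s) q)
      (fun q hq => sub_nonneg.2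
        (stableKernel_weighted hα0 hat hbt ha hb hws hle hq).1) has
      (fun q hq => sub_pos.2
        ((stableKernel_weighted hα0 hat hbt ha hb hws hle (has.trans hq)).2 hw hq))
      (fun x hx => by
        rw [e]
        exact (L x hx).1.1.sub (L' x hx).1.1)
    obtain ⟨p2, m2⟩ := laplace_pos_antitone
      (h := fun q => atsWeight α σ k t * stableKernel α (atsUpper α σ k η t)
        (atsLower α σ k η t) q - atsWeight α σ k s * stableKernel α (atsUpper α σ k η s)
        (atsLower α σ k η s) q)
      (fun q hq => sub_nonneg.2
        (stableKernel_weighted hα0 hbt hat hb ha hws hle' hq).1) hbs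
      (fun q hq => sub_pos.2
        ((stableKernel_weighted hα0 hbt hat hb ha hws hle' (hbs.trans hq)).2 hw hq))
      (fun x hx => by
        rw [e]
        exact (L x hx).2.1.sub (L' x hx).2.1)
    have r1 : ∀ x, 0 < x → ∫ q in Set.Ioi 0, (atsWeight α σ k t *
        stableKernel α (atsLower α σ k η t) (atsUpper α σ k η t) q - atsWeight α σ k s *
        stableKernel α (atsLower α σ k η s) (atsUpper α σ k η s) q) * Real.exp (-(q * x))
        = atsJumpDensity α σ k η t x - atsJumpDensity α σ k η s x := by
      intro x hx
      rw [e, integral_sub (L x hx).1.1 (L' x hx).1.1, (L x hx).1.2, (L' x hx).1.2]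
    have r2 : ∀ x, 0 < x → ∫ q in Set.Ioi 0, (atsWeight α σ k t *
        stableKernel α (atsUpper α σ k η t) (atsLower α σ k η t) q - atsWeight α σ k s *
        stableKernel α (atsUpper α σ k η s) (atsLower α σ k η s) q) * Real.exp (-(q * x))
        = atsJumpDensity α σ k η t (-x) - atsJumpDensity α σ k η s (-x) := by
      intro x hx
      rw [e, integral_sub (L x hx).2.1 (L' x hx).2.1, (L x hx).2.2, (L' x hx).2.2]
    refine ⟨⟨fun x hx => ?_, m1.congr r1⟩, ⟨fun x hx => ?_, m2.congr r2⟩⟩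
    · rw [← r1 x hx]
      exact p1 x hx
    · rw [← r2 x hx]
      exact p2 x hx

end

/-! ### Truncated and normalized jump densities. -/

section

theorem IsJumpDensity.integrableOn_Ioi {m : Measure ℝ} {n : ℝ → ℝ} (h : IsJumpDensity m n) {ε : ℝ}
    (hε : 0 < ε) : IntegrableOn n (Set.Ioi ε) ∧ IntegrableOn n (Set.Iio (-ε)) := by
  have hS : IntegrableOn n {x : ℝ | ε ≤ |x|} := by
    have hms : MeasurableSet {x : ℝ | ε ≤ |x|} := measurableSet_le measurable_const measurable_norm
    have h1 : Integrable (fun x => (min 1 (x ^ 2))⁻¹ * (min 1 (x ^ 2) * n x))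
        (volume.restrict {x : ℝ | ε ≤ |x|}) := by
      refine (h.2.1.restrict (s := {x : ℝ | ε ≤ |x|})).bdd_mul (c := (min 1 (ε ^ 2))⁻¹)
        (Measurable.aestronglyMeasurable (by fun_prop)) ?_
      filter_upwards [self_mem_ae_restrict hms] with x hx
      have hx' : ε ≤ |x| := hx
      have hsq : ε ^ 2 ≤ x ^ 2 := by
        rw [← sq_abs x]
        gcongr
      rw [norm_inv, Real.norm_of_nonneg (by positivity)]
      gcongr
    refine h1.congr ?_
    filter_upwards [self_mem_ae_restrict hms] with x hx
    have hx' : ε ≤ |x| := hx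
    have hx0 : x ≠ 0 := abs_pos.1 (hε.trans_le hx')
    rw [inv_mul_cancel_left₀ (by positivity)]
  refine ⟨hS.mono_set fun x hx => ?_, hS.mono_set fun x hx => ?_⟩
  · have hx' : ε < x := hx
    exact hx'.le.trans (le_abs_self x)
  · have hx' : x < -ε := hx
    exact (by linarith : ε ≤ -x).trans (neg_le_abs x)

variable {ν : ℝ≥0 → ℝ → ℝ} {s t : ℝ≥0} {ε : ℝ}

theorem mPlus_antitoneOn (hε : 0 < ε)
    (hint : IntegrableOn (fun x => ν t x - ν s x) (Set.Ioi ε))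
    (hpos : ∀ x, 0 < x → 0 < ν t x - ν s x)
    (hanti : AntitoneOn (fun x => ν t x - ν s x) (Set.Ioi 0)) :
    0 < (∫ x in Set.Ioi ε, (ν t x - ν s x)) ∧ AntitoneOn (mPlus ν ε s t) (Set.Ioi ε) := by
  have h0 : 0 < ∫ x in Set.Ioi ε, (ν t x - ν s x) := by
    rw [setIntegral_pos_iff_support_of_nonneg_ae _ hint]
    · refine lt_of_lt_of_le ?_ (measure_mono (s := Set.Ioi ε) fun x hx => ⟨?_, hx⟩)
      · simp
      · exact (hpos x (hε.trans hx)).ne'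
    · filter_upwards [self_mem_ae_restrict measurableSet_Ioi] with x hx
      exact (hpos x (hε.trans hx)).le
  refine ⟨h0, fun x hx y hy hxy => ?_⟩
  rw [mPlus, mPlus, Set.indicator_of_mem hx, Set.indicator_of_mem hy]
  exact div_le_div_of_nonneg_right (hanti (hε.trans hx) (hε.trans hy) hxy) h0.le

theorem mMinus_monotoneOn (hε : 0 < ε)
    (hint : IntegrableOn (fun x => ν t x - ν s x) (Set.Iio (-ε)))
    (hpos : ∀ x, 0 < x → 0 < ν t (-x) - ν s (-x))
    (hanti : AntitoneOn (fun x => ν t (-x) - ν s (-x)) (Set.Ioi 0)) :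
    0 < (∫ x in Set.Iio (-ε), (ν t x - ν s x)) ∧
      MonotoneOn (mMinus ν ε s t) (Set.Iio (-ε)) := by
  have hneg : ∀ x ∈ Set.Iio (-ε), 0 < -x := by
    intro x hx
    have : x < -ε := hx
    linarith
  have hpos' : ∀ x ∈ Set.Iio (-ε), 0 < ν t x - ν s x := by
    intro x hx
    simpa using hpos (-x) (hneg x hx)
  have h0 : 0 < ∫ x in Set.Iio (-ε), (ν t x - ν s x) := by
    rw [setIntegral_pos_iff_support_of_nonneg_ae _ hint]
    · refine lt_of_lt_of_le ?_ (measure_mono (s := Set.Iio (-ε)) fun x hx => ⟨?_, hx⟩)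
      · simp
      · exact (hpos' x hx).ne'
    · filter_upwards [self_mem_ae_restrict measurableSet_Iio] with x hx
      exact (hpos' x hx).le
  refine ⟨h0, fun x hx y hy hxy => ?_⟩
  rw [mMinus, mMinus, Set.indicator_of_mem hx, Set.indicator_of_mem hy]
  refine div_le_div_of_nonneg_right ?_ h0.le
  simpa using hanti (hneg y hy) (hneg x hx) (neg_le_neg hxy)

end

/-! ### Lévy measure and jump monotonicity for the process. -/

section

variable {Ω : Type*} [MeasurableSpace Ω] {P : Measure Ω}
  {α : ℝ} {σ k η : ℝ≥0 → ℝ} {f : ℝ≥0 → Ω → ℝ}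

theorem IsATSProcess.isJumpDensity (hα0 : 0 < α) (hα1 : α < 1)
    (hpar : IsATSParameters α σ k η) (hf : IsATSProcess P α σ k η f) (t : ℝ≥0) :
    IsJumpDensity (law P f t) (atsJumpDensity α σ k η t) := by
  rcases (zero_le (a := t)).eq_or_lt with rfl | ht
  · refine ⟨fun x => (atsJumpDensity_zero x).ge, by simp [atsJumpDensity_zero],
      0, 0, le_rfl, fun u => ?_⟩
    rw [hf.charFun_law_zero]
    simp [atsJumpDensity_zero]
  · exact isJumpDensity_of_charFun_eq_exp hα0 hα1 (abs_half_add_lt_atsRoot hα1 hpar ht)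
      (atsWeight_pos hα0 hα1 hpar ht).le
      (div_mul_cancel₀ _ (Gamma_mul_Gamma_pos hα0 hα1).ne').symm
      (hf.charFun_law_pos hα0 hα1 hpar ht) (atsJumpDensity_at_zero hα0 t)
      (fun x hx => atsJumpDensity_eq_expMixture hα0 hα1 hpar ht hx)

theorem IsATSProcess.jumpDensitiesMonotone [IsProbabilityMeasure P] (hα0 : 0 < α) (hα1 : α < 1)
    (hpar : IsATSParameters α σ k η) (hf : IsATSProcess P α σ k η f)
    (hnd : ∀ s t : ℝ≥0, s < t → ¬ (f t =ᵐ[P] f s)) :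
    JumpDensitiesMonotone P f (atsJumpDensity α σ k η) := by
  refine ⟨hf.isJumpDensity hα0 hα1 hpar, fun s t hst ε hε => ?_⟩
  obtain ⟨⟨p1, m1⟩, ⟨p2, m2⟩⟩ := increment_jumpDensity_pos_antitone hα0 hα1 hpar hst
    (hf.atsScale_lt hα0 hα1 hpar hnd hst)
  have it := (hf.isJumpDensity hα0 hα1 hpar t).integrableOn_Ioi hε
  have is := (hf.isJumpDensity hα0 hα1 hpar s).integrableOn_Ioi hε
  exact ⟨⟨it.1.sub is.1, mPlus_antitoneOn hε (it.1.sub is.1) p1 m1⟩,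
    ⟨it.2.sub is.2, mMinus_monotoneOn hε (it.2.sub is.2) p2 m2⟩⟩

end

/-! ### Decay of the characteristic function of an increment -/

section

variable {α a b : ℝ}

/-- The base equals `u² (1 + δ)` with `δ = O(1/u)` uniformly in `0 < y < a`, and `(1 + δ)^α` is
continuous at `δ = 0`. -/
theorem eventually_re_stableBase_cpow (ha : 0 < a) (hb : 0 < b) {ε : ℝ} (hε : 0 < ε) :
    ∀ᶠ u : ℝ in atTop, ∀ y : ℝ, 0 < y → y < a →
      |(((a - Complex.I * (u - Complex.I * y)) * (b + Complex.I * (u - Complex.I * y)))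
        ^ (α : ℂ)).re - u ^ (2 * α)| ≤ ε * u ^ (2 * α) := by
  have hcont : ContinuousAt (fun w : ℂ => (1 + w) ^ (α : ℂ)) 0 := by
    have : (1 : ℂ) + 0 ∈ Complex.slitPlane := by simp
    exact (continuousAt_const.add continuousAt_id).cpow continuousAt_const this
  obtain ⟨r, hr, hball⟩ := Metric.continuousAt_iff.1 hcont ε hε
  have hlim : Tendsto (fun u : ℝ => (a + b) ^ 2 * (u⁻¹ * u⁻¹) + 3 * (a + b) * u⁻¹) atTop (𝓝 0) := by
    have h := tendsto_inv_atTop_zero (𝕜 := ℝ)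
    simpa using ((h.mul h).const_mul ((a + b) ^ 2)).add (h.const_mul (3 * (a + b)))
  filter_upwards [eventually_gt_atTop 0, hlim.eventually_lt_const hr] with u hu hur y hy hya
  set δ : ℂ := (((a - y) * (b + y) / u ^ 2 : ℝ) : ℂ) + ((a - b - 2 * y) / u : ℝ) * Complex.I with hδ
  have hu' : (u : ℂ) ≠ 0 := by exact_mod_cast hu.ne'
  have hW : (a - Complex.I * (u - Complex.I * y)) * (b + Complex.I * (u - Complex.I * y))
      = ((u ^ 2 : ℝ) : ℂ) * (1 + δ) := by
    rw [hδ]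
    push_cast
    field_simp
    linear_combination (-(u : ℂ) ^ 2 + 2 * u * y * Complex.I - (a - b) * y
      - y ^ 2 * Complex.I ^ 2 + y ^ 2 : ℂ) * Complex.I_sq
  have hδn : ‖δ‖ < r := by
    refine lt_of_le_of_lt ?_ hur
    refine (norm_add_le _ _).trans ?_
    rw [norm_mul, Complex.norm_I, mul_one, Complex.norm_real, Complex.norm_real, Real.norm_eq_abs,
      Real.norm_eq_abs, abs_div, abs_div, abs_of_pos hu, abs_of_pos (by positivity : 0 < u ^ 2),
      ← mul_inv, ← sq, ← div_eq_mul_inv, ← div_eq_mul_inv]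
    have h1 : |(a - y) * (b + y)| ≤ (a + b) ^ 2 := by
      rw [abs_of_pos (mul_pos (by linarith) (by linarith))]
      nlinarith
    have h2 : |a - b - 2 * y| ≤ 3 * (a + b) := by
      rw [abs_le]
      constructor <;> linarith
    gcongr
  have hne : (1 : ℂ) + δ ≠ 0 := by
    have hre : 0 < ((1 : ℂ) + δ).re := by
      have : 0 < (a - y) * (b + y) / u ^ 2 :=
        div_pos (mul_pos (by linarith) (by linarith)) (by positivity)
      rw [hδ]
      simp only [Complex.add_re, Complex.one_re, Complex.ofReal_re, Complex.re_ofReal_mul,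
        Complex.I_re, mul_zero, add_zero]
      linarith
    intro h
    rw [h] at hre
    simp at hre
  have hclose : ‖(1 + δ) ^ (α : ℂ) - 1‖ < ε := by
    have := hball (x := δ) (by simpa using hδn)
    simpa [dist_eq_norm] using this
  have hp : (u ^ 2) ^ α = u ^ (2 * α) := by
    rw [Real.rpow_mul hu.le, Real.rpow_two]
  have hup : 0 ≤ u ^ (2 * α) := by positivity
  rw [hW, ofReal_mul_cpow (by positivity) hne, hp, Complex.re_ofReal_mul,
    show u ^ (2 * α) * ((1 + δ) ^ (α : ℂ)).re - u ^ (2 * α)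
      = ((1 + δ) ^ (α : ℂ) - 1).re * u ^ (2 * α) by simp; ring, abs_mul, abs_of_nonneg hup]
  gcongr
  exact (Complex.abs_re_le_norm _).trans hclose.le

theorem re_stableExponent (B c u y : ℝ) :
    (stableExponent α a b B c (u - Complex.I * y)).re = B * (a * b) ^ α
      - B * (((a - Complex.I * (u - Complex.I * y)) * (b + Complex.I * (u - Complex.I * y)))
        ^ (α : ℂ)).re - y * c := by
  have e : Complex.I * (u - Complex.I * y) * c = ((y * c : ℝ) : ℂ) + ((u * c : ℝ) : ℂ) * Complex.I := by
    push_cast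
    linear_combination (-(y : ℂ) * c) * Complex.I_sq
  rw [stableExponent, e, Complex.sub_re, Complex.sub_re, Complex.re_ofReal_mul]
  simp

/-- The quotient of two tempered stable characteristic functions decays like a stretched
exponential when the scale of the numerator is larger. -/
theorem exp_stableExponent_sub_decay (hα0 : 0 < α) (ha : 0 < a) (hb : 0 < b) {a' b' B B' c c' : ℝ}
    (ha' : a ≤ a') (hb' : 0 < b') (hB' : 0 ≤ B') (hBB : B' < B) :
    ∃ K d ω : ℝ, 0 < K ∧ 0 < d ∧ 0 < ω ∧ ∀ᶠ u : ℝ in atTop, ∀ y : ℝ, 0 < y → y < a →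
      ‖Complex.exp (stableExponent α a b B c (u - Complex.I * y)
        - stableExponent α a' b' B' c' (u - Complex.I * y))‖ < K * Real.exp (-d * u ^ ω) := by
  set M := |B * (a * b) ^ α| + |B' * (a' * b') ^ α| + a * (|c| + |c'|) with hM
  -- Chosen so that `-B (1 - ε) + B' (1 + ε) = -(B - B') / 2`, which becomes the decay rate.
  set ε := (B - B') / (2 * (B + B')) with hε
  have hBs : 0 < B + B' := by linarith
  have hBd : 0 < B - B' := by linarith
  have hε0 : 0 < ε := by positivity
  have hεB : ε * (B + B') = (B - B') / 2 := by
    rw [hε]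
    field_simp
  -- The factor `2` only makes the inequality strict.
  refine ⟨2 * Real.exp M, (B - B') / 2, 2 * α, by positivity, by positivity, by positivity, ?_⟩
  filter_upwards [eventually_gt_atTop 0, eventually_re_stableBase_cpow (α := α) ha hb hε0,
    eventually_re_stableBase_cpow (α := α) (ha.trans_le ha') hb' hε0] with u hu h1 h2 y hy hya
  have e1 := abs_le.1 (h1 y hy hya)
  have e2 := abs_le.1 (h2 y hy (hya.trans_le ha'))
  rw [Complex.norm_exp, Complex.sub_re, re_stableExponent, re_stableExponent]
  set X := (((a - Complex.I * (u - Complex.I * y)) * (b + Complex.I * (u - Complex.I * y)))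
        ^ (α : ℂ)).re
  set Y := (((a' - Complex.I * (u - Complex.I * y)) * (b' + Complex.I * (u - Complex.I * y)))
        ^ (α : ℂ)).re
  set U := u ^ (2 * α)
  have hX : B * ((1 - ε) * U) ≤ B * X := by
    have : 0 < B := by linarith
    gcongr
    linarith [e1.1]
  have hY : B' * Y ≤ B' * ((1 + ε) * U) := by
    gcongr
    linarith [e2.2]
  have hc : -(y * c) + y * c' ≤ a * (|c| + |c'|) := by
    have k1 : -c ≤ |c| := neg_le_abs c
    have k2 : c' ≤ |c'| := le_abs_self c'
    have k3 : 0 ≤ |c| + |c'| := by positivity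
    nlinarith
  have hεU : ε * (B + B') * U = (B - B') / 2 * U := by rw [hεB]
  have hle : B * (a * b) ^ α - B * X - y * c - (B' * (a' * b') ^ α - B' * Y - y * c')
      ≤ M + -((B - B') / 2) * U := by
    have k1 := le_abs_self (B * (a * b) ^ α)
    have k2 := neg_le_abs (B' * (a' * b') ^ α)
    rw [hM]
    linarith
  calc _ ≤ Real.exp (M + -((B - B') / 2) * U) := Real.exp_le_exp.2 hle
    _ = Real.exp M * Real.exp (-((B - B') / 2) * U) := Real.exp_add _ _
    _ < 2 * Real.exp M * Real.exp (-((B - B') / 2) * U) := by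
      have : 0 < Real.exp M * Real.exp (-((B - B') / 2) * U) := by positivity
      linarith

end

/-! ### Decay for the increments of the process. -/

section

variable {Ω : Type*} [MeasurableSpace Ω] {P : Measure Ω} [IsProbabilityMeasure P]
  {α : ℝ} {σ k η : ℝ≥0 → ℝ} {f : ℝ≥0 → Ω → ℝ}

theorem IsATSProcess.incrementCharFunDecay (hα0 : 0 < α) (hα1 : α < 1)
    (hpar : IsATSParameters α σ k η) (hf : IsATSProcess P α σ k η f)
    (hnd : ∀ s t : ℝ≥0, s < t → ¬ (f t =ᵐ[P] f s)) :
    IncrementCharFunDecay P f := by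
  intro s t hst
  have ht : 0 < t := lt_of_le_of_lt zero_le hst
  have hat := zero_lt_one.trans (one_lt_atsLower hα1 hpar ht)
  have hbt := atsUpper_pos hα1 hpar ht
  have hlt := hf.atsScale_lt hα0 hα1 hpar hnd hst
  obtain ⟨a', b', B', c', ha', hb', hB', hBB, hs⟩ : ∃ a' b' B' c' : ℝ,
      atsLower α σ k η t ≤ a' ∧ atsUpper α σ k η t ≤ b' ∧ 0 ≤ B' ∧ B' < atsScale α σ k t ∧
      ∀ u : ℝ, charFun (law P f s) u = Complex.exp (stableExponent α a' b' B' c' u) := by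
    rcases (zero_le (a := s)).eq_or_lt with rfl | hs
    -- At `s = 0` the characteristic function is `1`: the scale and drift are `0`, and the strip of
    -- time `t` can be reused.
    · refine ⟨_, _, 0, 0, le_rfl, le_rfl, le_rfl, atsScale_pos hα0 hα1 hpar ht, fun u => ?_⟩
      rw [hf.charFun_law_zero]
      simp [stableExponent]
    · exact ⟨_, _, _, _, atsLower_antitone hpar hs ht hst.le, atsUpper_antitone hpar hs ht hst.le,
        (atsScale_pos hα0 hα1 hpar hs).le, hlt, hf.charFun_law_pos hα0 hα1 hpar hs⟩
  have hp : pPlus P f t + 1 = ((atsLower α σ k η t : ℝ) : EReal) := by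
    rw [hf.pPlus_pos hα0 hα1 hpar ht, ← EReal.coe_one, ← EReal.coe_add, sub_add_cancel]
  obtain ⟨K, d, ω, hK, hd, hω, hev⟩ := exp_stableExponent_sub_decay hα0 hat hbt ha'
    (hbt.trans_le hb') hB' hBB (c := atsDrift α σ k η t) (c' := c')
  refine ⟨fun z => Complex.exp (stableExponent α (atsLower α σ k η t) (atsUpper α σ k η t)
    (atsScale α σ k t) (atsDrift α σ k η t) z - stableExponent α a' b' B' c' z), ⟨?_, fun u => ?_⟩,
    K, d, ω, hK, hd, hω, ?_⟩
  · rw [hp, hf.pMinus_pos hα0 hα1 hpar ht, ← EReal.coe_neg]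
    -- The strip of the earlier exponent contains that of time `t`, so the difference of exponents
    -- is analytic there.
    refine ((differentiableOn_stableExponent _ _ _ _ _).sub
      ((differentiableOn_stableExponent _ _ _ _ _).mono fun z hz => ?_)).cexp
    rw [mem_strip_coe] at hz ⊢
    exact ⟨by linarith [hz.1], by linarith [hz.2]⟩
  · have h := hf.additive.charFun_law_mul hst.le u
    rw [hs, hf.charFun_law_pos hα0 hα1 hpar ht] at h
    change Complex.exp (_ - _) = _
    rw [Complex.exp_sub, ← h, mul_div_cancel_left₀ _ (Complex.exp_ne_zero _)]
  · filter_upwards [hev] with u hu y hy hya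
    rw [hp, EReal.coe_lt_coe_iff] at hya
    exact hu y hy hya

end

end AdditiveSim

theorem proposition2 {Ω : Type*} [MeasurableSpace Ω] (P : Measure Ω) [IsProbabilityMeasure P]
    (α : ℝ) (hα0 : 0 < α) (hα1 : α < 1) (σ k η : ℝ≥0 → ℝ)
    (hpar : AdditiveSim.IsATSParameters α σ k η)
    (f : ℝ≥0 → Ω → ℝ) (hf : AdditiveSim.IsATSProcess P α σ k η f)
    (hnd : ∀ s t : ℝ≥0, s < t → ¬ (f t =ᵐ[P] f s)) :
    (∀ t, 0 < AdditiveSim.pPlus P f t ∧ 0 < AdditiveSim.pMinus P f t) ∧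
    AdditiveSim.StripNonincreasing P f ∧
    AdditiveSim.IncrementCharFunDecay P f ∧
    AdditiveSim.JumpDensitiesMonotone P f (AdditiveSim.atsJumpDensity α σ k η) ∧
    (∀ t, AdditiveSim.pMinus P f t ≤ AdditiveSim.pPlus P f t) ∧
    (∀ t, 0 < t →
      AdditiveSim.pPlus P f t - AdditiveSim.pMinus P f t = ((2 * η t : ℝ) : EReal)) :=
  ⟨hf.strip_pos hα0 hα1 hpar, hf.stripNonincreasing hα0 hα1 hpar,
    hf.incrementCharFunDecay hα0 hα1 hpar hnd, hf.jumpDensitiesMonotone hα0 hα1 hpar hnd,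
    hf.pMinus_le_pPlus hα0 hα1 hpar, fun _ ht => hf.pPlus_sub_pMinus hα0 hα1 hpar ht⟩
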